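/- Let $\psi=\Gamma'/\Gamma$ be the digamma function, $G=\sum_{k=0}^\infty\frac{(-1)^k}{(2k+1)^2}$ Catalan's constant, $H_m=\sum_{i=1}^m\frac1i$ the harmonic numbers, and $\mathrm{Li}_3$ the principal branch of the trilogarithm, i.e. the analytic continuation of $\sum_{k\ge1}z^k/k^3$ to $\mathbb{C}\setminus[1,\infty)$. For every integer $n\ge 0$ the series $$\Theta_1(n,0)=\sum_{k=1}^\infty\frac{\psi\left(\frac{2k+2n+5}{4}\right)-\psi\left(\frac{2k+2n+3}{4}\right)}{(2k)^2}$$ converges, and its value is as follows (empty sums are $0$). - If $n=0$: $$\Theta_1(0,0)=-4+4\ln2-\frac{\pi}{2}\ln^22+\frac{\pi^2}{6}-\frac{11\pi^3}{48}-4G\ln2+8\,\mathrm{Im}\,\mathrm{Li}_3(1+i).$$ - If $n=1$: $$\Theta_1(1,0)=\frac{92}{27}-\frac{\pi^2}{9}-\frac{32\ln2}{9}+\frac{\pi}{2}\ln^22+\frac{11\pi^3}{48}+4G\ln2-8\,\mathrm{Im}\,\mathrm{Li}_3(1+i).$$ - If $n$ is odd and $n\neq1$: $$\begin{aligned}\T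heta_1(n,0)={}&\frac{92}{27}+16\sum_{j=1}^{\frac{n-1}{2}}\frac{(2j+1)(2H_{4j+1}-H_{2j})}{(4j+3)^2(4j+1)^2}-4\sum_{j=1}^{\frac{n-1}{2}}\frac{1}{(4j+3)^3}\\&-\pi^2\left(\frac19+\frac13\sum_{j=1}^{\frac{n-1}{2}}\frac{1}{(4j+3)(4j+1)}\right)-\ln2\left(\frac{32}{9}+32\sum_{j=1}^{\frac{n-1}{2}}\frac{2j+1}{(4j+3)^2(4j+1)^2}\right)\\&+\frac{\pi}{2}\ln^22+\frac{11\pi^3}{48}+4G\ln2-8\,\mathrm{Im}\,\mathrm{Li}_3(1+i).\end{aligned}$$ - If $n$ is even: $$\begin{aligned}\Theta_1(n,0)={}&-4+32\sum_{j=0}^{\frac{n-2}{2}}\frac{(j+1)(2H_{4j+3}-H_{2j+1})}{(4j+5)^2(4j+3)^2}-4\sum_{j=0}^{\frac{n-2}{2}}\frac{1}{(4j+5)^3}\\&+\pi^2\left(\frac16-\frac13\sum_{j=0}^{\frac{n-2}{2}}\frac{1}{(4j+5)(4j+3)}\right)+\ln2\left(4-64\sum_{j=0}^{\frac{n-2}{2}}\frac{j+1}{(4j+5)^2(4j+3)^2}\right)\\&-\frac{\pi}{2}\ln^22-\frac{11\pi^3}{48}-4G\ln2+8\,\mathrm{Im}\,\mathrm{Li}_3(1+i).\end{aligned}$$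 -/

import Mathlib

/-- The trilogarithm `Li₃` on `ℂ ∖ (1, ∞)`, through its classical integral representation
`Li₃(z) = (1/2) ∫₀¹ z ln² t / (1 - z t) dt`. The facts `hasSum_trilog` and `differentiableOn_trilog`
below show that it equals `∑_{n ≥ 1} zⁿ / n³` for `|z| ≤ 1` and that it is the analytic continuation
of this series to the complex plane cut along `[1, ∞)`. -/
noncomputable def trilog (z : ℂ) : ℂ :=
  ∫ t in (0 : ℝ)..1, z * ((Real.log t : ℝ) : ℂ) ^ 2 / (2 * (1 - z * (t : ℂ)))

/-- Catalan's constant `G = ∑_{k ≥ 0} (-1)ᵏ / (2k+1)²`. -/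
noncomputable def catalanConstant : ℝ :=
  ∑' k : ℕ, (-1 : ℝ) ^ k / (2 * (k : ℝ) + 1) ^ 2

/-- The summand `(ψ((2k+2n+5)/4) - ψ((2k+2n+3)/4)) / (2k)²`, where `ψ` is the digamma function. -/
noncomputable def digammaTerm (n k : ℕ) : ℂ :=
  (Complex.digamma ((2 * (k : ℂ) + 2 * (n : ℂ) + 5) / 4)
    - Complex.digamma ((2 * (k : ℂ) + 2 * (n : ℂ) + 3) / 4)) / (2 * (k : ℂ)) ^ 2

theorem integral_pow_mul_log_sq (n : ℕ) :
    IntervalIntegrable (fun t : ℝ => t ^ n * Real.log t ^ 2) MeasureTheory.volume 0 1 ∧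
      ∫ t in (0 : ℝ)..1, t ^ n * Real.log t ^ 2 = 2 / ((n : ℝ) + 1) ^ 3 := by
  have hn : (n : ℝ) + 1 ≠ 0 := by positivity
  set F : ℝ → ℝ := fun t => t ^ n * (t * Real.log t ^ 2) / ((n : ℝ) + 1)
    - 2 * (t ^ n * (t * Real.log t)) / ((n : ℝ) + 1) ^ 2
    + 2 * t ^ (n + 1) / ((n : ℝ) + 1) ^ 3 with hF
  have h2 : ContinuousOn (fun t : ℝ => t * Real.log t ^ 2) (Set.Icc 0 1) := by
    have hc : Continuous (fun t : ℝ => 4 * (√t * Real.log (√t)) ^ 2) :=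
      continuous_const.mul ((Real.continuous_mul_log.comp Real.continuous_sqrt).pow 2)
    refine hc.continuousOn.congr fun t ht => ?_
    simp only
    rw [Real.log_sqrt ht.1, mul_pow, Real.sq_sqrt ht.1]
    ring
  have hcont : ContinuousOn F (Set.Icc 0 1) := by
    have h1 : Continuous (fun t : ℝ => t * Real.log t) := Real.continuous_mul_log
    have h3 : ContinuousOn (fun t : ℝ => t ^ n * (t * Real.log t ^ 2)) (Set.Icc 0 1) :=
      (continuous_pow n).continuousOn.mul h2
    have h4 : Continuous (fun t : ℝ => 2 * (t ^ n * (t * Real.log t)) / ((n : ℝ) + 1) ^ 2) :=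
      (continuous_const.mul ((continuous_pow n).mul h1)).div_const _
    have h5 : Continuous (fun t : ℝ => 2 * t ^ (n + 1) / ((n : ℝ) + 1) ^ 3) := by fun_prop
    exact ((h3.div_const _).sub h4.continuousOn).add h5.continuousOn
  have hderiv : ∀ t ∈ Set.Ioo (0 : ℝ) 1, HasDerivAt F (t ^ n * Real.log t ^ 2) t := by
    intro t ht
    have ht0 : t ≠ 0 := ht.1.ne'
    have hl := Real.hasDerivAt_log ht0
    have hp := hasDerivAt_pow (n + 1) t
    have e : F = fun t => t ^ (n + 1) * Real.log t ^ 2 / ((n : ℝ) + 1)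
        - 2 * (t ^ (n + 1) * Real.log t) / ((n : ℝ) + 1) ^ 2
        + 2 * t ^ (n + 1) / ((n : ℝ) + 1) ^ 3 := by
      funext t
      simp only [hF]
      ring
    rw [e]
    refine ((((hp.mul (hl.pow 2)).div_const _).sub
      (((hp.mul hl).const_mul 2).div_const _)).add
        ((hp.const_mul 2).div_const _)).congr_deriv ?_
    push_cast
    simp only [Pi.pow_apply]
    field_simp
    ring
  have hint : IntervalIntegrable (fun t : ℝ => t ^ n * Real.log t ^ 2)
      MeasureTheory.volume 0 1 := by
    refine intervalIntegral.intervalIntegrable_deriv_of_nonneg (g := F) ?_ ?_ ?_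
    · simpa [Set.uIcc_of_le] using hcont
    · simpa using hderiv
    · intro t ht
      have h0 : 0 < t := by simpa using ht.1
      positivity
  refine ⟨hint, ?_⟩
  rw [intervalIntegral.integral_eq_sub_of_hasDerivAt_of_le zero_le_one hcont hderiv hint]
  simp [hF]

/-- On the closed unit disc, `trilog` is the series `∑_{n ≥ 1} zⁿ / n³`. -/
theorem hasSum_trilog {z : ℂ} (hz : ‖z‖ ≤ 1) :
    HasSum (fun n : ℕ => z ^ (n + 1) / ((n : ℂ) + 1) ^ 3) (trilog z) := by
  set f : ℕ → ℝ → ℂ := fun n t =>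
    z ^ (n + 1) / 2 * ((t ^ n * Real.log t ^ 2 : ℝ) : ℂ) with hf
  have hi : ∀ n, MeasureTheory.Integrable (f n)
      (MeasureTheory.volume.restrict (Set.Ioc (0 : ℝ) 1)) := fun n =>
    ((((intervalIntegrable_iff_integrableOn_Ioc_of_le zero_le_one).1
      (integral_pow_mul_log_sq n).1).ofReal).const_mul _)
  have hnorm : ∀ n, ∫ t in Set.Ioc (0 : ℝ) 1, ‖f n t‖ = ‖z‖ ^ (n + 1) / ((n : ℝ) + 1) ^ 3 := by
    intro n
    have : ∫ t in Set.Ioc (0 : ℝ) 1, ‖f n t‖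
        = ∫ t in Set.Ioc (0 : ℝ) 1, ‖z‖ ^ (n + 1) / 2 * (t ^ n * Real.log t ^ 2) := by
      refine MeasureTheory.setIntegral_congr_fun measurableSet_Ioc fun t ht => ?_
      have h0 : 0 ≤ t ^ n * Real.log t ^ 2 := by
        have := ht.1
        positivity
      simp only [hf, norm_mul, norm_div, norm_pow, Complex.norm_real, Real.norm_of_nonneg h0]
      simp
    rw [this, MeasureTheory.integral_const_mul,
      ← intervalIntegral.integral_of_le zero_le_one, (integral_pow_mul_log_sq n).2]
    ring
  have hs : Summable fun n => ∫ t in Set.Ioc (0 : ℝ) 1, ‖f n t‖ := by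
    simp only [hnorm]
    have h3 : Summable fun n : ℕ => 1 / ((n : ℝ) + 1) ^ 3 := by
      have := (summable_nat_add_iff 1).2 (Real.summable_one_div_nat_pow.2 (by norm_num : 1 < 3))
      simpa using this
    refine Summable.of_nonneg_of_le (fun n => by positivity) (fun n => ?_) h3
    gcongr
    exact pow_le_one₀ (norm_nonneg _) hz
  have key := MeasureTheory.hasSum_integral_of_summable_integral_norm hi hs
  have e1 : ∀ n, ∫ t in Set.Ioc (0 : ℝ) 1, f n t = z ^ (n + 1) / ((n : ℂ) + 1) ^ 3 := by
    intro n
    simp only [hf]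
    rw [MeasureTheory.integral_const_mul, integral_complex_ofReal,
      ← intervalIntegral.integral_of_le zero_le_one, (integral_pow_mul_log_sq n).2]
    push_cast
    ring
  have e2 : ∫ t in Set.Ioc (0 : ℝ) 1, ∑' n, f n t = trilog z := by
    rw [trilog, intervalIntegral.integral_of_le zero_le_one,
      MeasureTheory.integral_Ioc_eq_integral_Ioo, MeasureTheory.integral_Ioc_eq_integral_Ioo]
    refine MeasureTheory.setIntegral_congr_fun measurableSet_Ioo fun t ht => ?_
    have hlt : ‖z * (t : ℂ)‖ < 1 := by
      rw [norm_mul, Complex.norm_real, Real.norm_of_nonneg ht.1.le]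
      nlinarith [ht.1, ht.2, norm_nonneg z]
    have hg := (hasSum_geometric_of_norm_lt_one hlt).mul_left
      (z * ((Real.log t : ℝ) : ℂ) ^ 2 / 2)
    have : (fun n : ℕ => f n t)
        = fun n => z * ((Real.log t : ℝ) : ℂ) ^ 2 / 2 * (z * (t : ℂ)) ^ n := by
      funext n
      simp only [hf]
      push_cast
      ring
    simp only [this, hg.tsum_eq]
    rw [mul_comm (2 : ℂ), div_mul_eq_div_div_swap, div_eq_mul_inv _ (1 - z * (t : ℂ))]
  simpa only [e1, e2] using key

/-- `trilog` is holomorphic on the complex plane cut along `[1, ∞)`. -/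
theorem differentiableOn_trilog :
    DifferentiableOn ℂ trilog {z : ℂ | 1 - z ∈ Complex.slitPlane} := by
  intro z hz
  have hopen : IsOpen {z : ℂ | 1 - z ∈ Complex.slitPlane} :=
    Complex.isOpen_slitPlane.preimage (by fun_prop)
  obtain ⟨ε, hε, hsub⟩ := Metric.nhds_basis_closedBall.mem_iff.1 (hopen.mem_nhds hz)
  have hne : ∀ w ∈ {z : ℂ | 1 - z ∈ Complex.slitPlane}, ∀ t ∈ Set.Icc (0 : ℝ) 1,
      1 - w * (t : ℂ) ≠ 0 := by
    intro w hw t ht h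
    have hre := congrArg Complex.re h
    have him := congrArg Complex.im h
    simp only [Complex.sub_re, Complex.one_re, Complex.mul_re, Complex.ofReal_re,
      Complex.ofReal_im, Complex.sub_im, Complex.one_im, Complex.mul_im, Complex.zero_re,
      Complex.zero_im, mul_zero, sub_zero, zero_add, zero_sub] at hre him
    have hw' : 0 < 1 - w.re ∨ w.im ≠ 0 := by
      simpa [Complex.mem_slitPlane_iff] using hw
    have ht0 : t ≠ 0 := by
      rintro rfl
      simp at hre
    rcases hw' with h1 | h1
    · have := mul_pos h1 (lt_of_le_of_ne ht.1 (Ne.symm ht0))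
      nlinarith [ht.2]
    · have : w.im * t = 0 := by linarith
      rcases mul_eq_zero.1 this with h | h
      · exact h1 h
      · exact ht0 h
  obtain ⟨p, hp, hmin⟩ := ((isCompact_closedBall z ε).prod
    (isCompact_Icc (a := (0 : ℝ)) (b := 1))).exists_isMinOn
      ⟨(z, 0), by simp [hε.le]⟩
      (f := fun p : ℂ × ℝ => ‖1 - p.1 * (p.2 : ℂ)‖) (by fun_prop)
  set c := ‖1 - p.1 * (p.2 : ℂ)‖ with hc
  have hcpos : 0 < c := norm_pos_iff.2 (hne _ (hsub hp.1) _ hp.2)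
  have hle : ∀ w ∈ Metric.closedBall z ε, ∀ t ∈ Set.Icc (0 : ℝ) 1,
      c ≤ ‖1 - w * (t : ℂ)‖ := fun w hw t ht => hmin (a := (w, t)) ⟨hw, ht⟩
  have hlog := (integral_pow_mul_log_sq 0).1
  simp only [pow_zero, one_mul] at hlog
  have hmeas : ∀ w : ℂ, MeasureTheory.AEStronglyMeasurable
      (fun t : ℝ => w * ((Real.log t : ℝ) : ℂ) ^ 2 / (2 * (1 - w * (t : ℂ))))
      (MeasureTheory.volume.restrict (Set.uIoc (0 : ℝ) 1)) := fun w =>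
    Measurable.aestronglyMeasurable (by fun_prop)
  have hIoc : Set.uIoc (0 : ℝ) 1 = Set.Ioc 0 1 := Set.uIoc_of_le zero_le_one
  have hzmem : z ∈ Metric.closedBall z ε := Metric.mem_closedBall_self hε.le
  refine (intervalIntegral.hasDerivAt_integral_of_dominated_loc_of_deriv_le
    (F := fun (w : ℂ) (t : ℝ) => w * ((Real.log t : ℝ) : ℂ) ^ 2 / (2 * (1 - w * (t : ℂ))))
    (F' := fun (w : ℂ) (t : ℝ) => ((Real.log t : ℝ) : ℂ) ^ 2 / (2 * (1 - w * (t : ℂ)) ^ 2))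
    (bound := fun t : ℝ => Real.log t ^ 2 * (1 / (2 * c ^ 2)))
    (Metric.closedBall_mem_nhds z hε) (Filter.Eventually.of_forall hmeas) ?_
    (Measurable.aestronglyMeasurable (by fun_prop)) (Filter.Eventually.of_forall ?_)
    (hlog.mul_const _) (Filter.Eventually.of_forall ?_)).2.differentiableAt.differentiableWithinAt
  · refine (hlog.mul_const (‖z‖ / (2 * c))).mono_fun (hmeas z) ?_
    refine (MeasureTheory.ae_restrict_iff' measurableSet_uIoc).2
      (Filter.Eventually.of_forall fun t ht => ?_)
    rw [hIoc] at ht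
    have h := hle z hzmem t ⟨ht.1.le, ht.2⟩
    simp only
    rw [Real.norm_of_nonneg (by positivity : 0 ≤ Real.log t ^ 2 * (‖z‖ / (2 * c)))]
    simp only [norm_div, norm_mul, norm_pow, Complex.norm_real, Complex.norm_ofNat,
      Real.norm_eq_abs, sq_abs]
    calc ‖z‖ * Real.log t ^ 2 / (2 * ‖1 - z * (t : ℂ)‖)
        ≤ ‖z‖ * Real.log t ^ 2 / (2 * c) := by gcongr
      _ = Real.log t ^ 2 * (‖z‖ / (2 * c)) := by ring
  · intro t ht w hw
    rw [hIoc] at ht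
    have h := hle w hw t ⟨ht.1.le, ht.2⟩
    simp only [norm_div, norm_mul, norm_pow, Complex.norm_real, Complex.norm_ofNat,
      Real.norm_eq_abs, sq_abs]
    calc Real.log t ^ 2 / (2 * ‖1 - w * (t : ℂ)‖ ^ 2)
        ≤ Real.log t ^ 2 / (2 * c ^ 2) := by gcongr
      _ = Real.log t ^ 2 * (1 / (2 * c ^ 2)) := by ring
  · intro t ht w hw
    rw [hIoc] at ht
    have h0 := hne w (hsub hw) t ⟨ht.1.le, ht.2⟩
    have hn := (hasDerivAt_id w).mul_const (((Real.log t : ℝ) : ℂ) ^ 2)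
    have hd := (((hasDerivAt_id w).mul_const (t : ℂ)).const_sub 1).const_mul 2
    have := hn.div hd (by simpa using h0)
    refine this.congr_deriv ?_
    simp only [id]
    field_simp
    ring

/-! Write `a_j = ∫₀¹ x^(2j)/(1+x²) dx`. The digamma difference in the `k`-th term equals `4
a_(k+n+1)`, because both sides obey the same two-term recursion and agree at the start by the
reflection formula (`digamma_sub_digamma`). So the series is `Θ(n) = ∑_{k≥1} a_(k+n+1)/k²`. Since
`a_j + a_(j+1) = 1/(2j+1)`, one has `Θ(n) + Θ(n-1) = ∑ 1/(k²(2k+2n+1))`, which is elementary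
(`hasSum_invSqOddSum`). The recursion gives the finite sums and the dependence on the parity of `n`,
and it leaves one constant, `J = ∑ a_k/k²`, which plays the role of `Θ(-1)`.

Integration by parts and summation under the integral give `J = π³/24 + 2 ∫₀¹ arctan x · log(1-x²)/x
dx` (`hasSum_arctanMoment_div_sq`). The last integrand is the imaginary part of `(1/x) (log²(1+ix) -
½ log²((1+x)/(1+ix)) - ½ log²((1-x)/(1+ix)))`.

In each of the three terms take the argument of the logarithm as the new variable `u`. This turns
`dx/x` into `du/(u-1)`, `du/(u-1) - du/(u+i)` and `du/(u-1) - du/(u-i)` respectively, along paths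
from `1` to `1+i`, `1-i` and `0`. By Cauchy's theorem a path integral is a difference of integrals
along segments from `0` (`IsLogBounded.integral_path`), where `log (t z) = log t + log z` leaves
real integrals of `1`, `log t`, `log² t` against rational functions.

The segments to `1±i` have denominator `2t²-2t+1`, and the `log² t` integral is `2 Im Li₃(1+i)`. The
two integrals with a single `log t` follow from the same contour argument applied to `∫ log(1+ix)/x
dx = π²/48 + iG`. The segment to `1` contributes `∫ log² t/(1+t²) dt = π³/16`. -/

/-! ### Digamma differences as moments of `1/(1+x²)`. -/

/-- The moments `∫₀¹ x^(2j) / (1 + x²) dx`. -/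
noncomputable def arctanMoment (j : ℕ) : ℝ :=
  ∫ x in (0 : ℝ)..1, x ^ (2 * j) / (1 + x ^ 2)

theorem continuous_pow_div_one_add_sq (m : ℕ) :
    Continuous fun x : ℝ => x ^ m / (1 + x ^ 2) :=
  (continuous_pow m).div (by fun_prop) fun x => by positivity

theorem arctanMoment_zero : arctanMoment 0 = Real.pi / 4 := by
  simp [arctanMoment]

theorem arctanMoment_add_succ (j : ℕ) :
    arctanMoment j + arctanMoment (j + 1) = 1 / (2 * (j : ℝ) + 1) := by
  rw [arctanMoment, arctanMoment, ← intervalIntegral.integral_add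
    ((continuous_pow_div_one_add_sq _).intervalIntegrable _ _)
    ((continuous_pow_div_one_add_sq _).intervalIntegrable _ _)]
  have h : ∀ x : ℝ, x ^ (2 * j) / (1 + x ^ 2) + x ^ (2 * (j + 1)) / (1 + x ^ 2) = x ^ (2 * j) := by
    intro x
    have : 1 + x ^ 2 ≠ 0 := by positivity
    field_simp
    ring
  simp only [h]
  rw [integral_pow]
  simp

/-- The logarithmic derivative of `Γ(z) Γ(1-z) = π / sin (π z)` is `ψ(1-z) - ψ(z) = π cot (π z)`,
and the cotangent is `1` at `z = 1/4`. -/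
theorem digamma_three_quarters_sub_one_quarter :
    Complex.digamma (3 / 4) - Complex.digamma (1 / 4) = Real.pi := by
  have hpi : (Real.pi : ℂ) ≠ 0 := by exact_mod_cast Real.pi_ne_zero
  have hG : ∀ z : ℂ, 0 < z.re → DifferentiableAt ℂ Complex.Gamma z := fun z hz =>
    Complex.differentiableAt_Gamma _ fun m h => by
      have := congrArg Complex.re h
      simp at this
      have : (0 : ℝ) ≤ m := by positivity
      linarith
  have h14 : (0 : ℝ) < (1 / 4 : ℂ).re := by norm_num
  have h34 : (0 : ℝ) < (1 - 1 / 4 : ℂ).re := by norm_num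
  have hs : Complex.sin (Real.pi * (1 / 4)) ≠ 0 := by
    have : ((Real.pi : ℂ) * (1 / 4)) = ((Real.pi / 4 : ℝ) : ℂ) := by push_cast; ring
    rw [this, ← Complex.ofReal_sin, Real.sin_pi_div_four]
    have : (√2 / 2 : ℝ) ≠ 0 := by positivity
    exact_mod_cast this
  have hc : Complex.cos (Real.pi * (1 / 4)) = Complex.sin (Real.pi * (1 / 4)) := by
    have : ((Real.pi : ℂ) * (1 / 4)) = ((Real.pi / 4 : ℝ) : ℂ) := by push_cast; ring
    rw [this, ← Complex.ofReal_sin, ← Complex.ofReal_cos, Real.sin_pi_div_four,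
      Real.cos_pi_div_four]
  have d1 := (hG _ h14).hasDerivAt
  have d2 : HasDerivAt (fun z : ℂ => Complex.Gamma (1 - z))
      (deriv Complex.Gamma (1 - 1 / 4) * (-1)) (1 / 4) :=
    HasDerivAt.comp (h₂ := Complex.Gamma) (h := fun z : ℂ => 1 - z) (1 / 4 : ℂ)
      (hG _ h34).hasDerivAt ((hasDerivAt_id _).const_sub 1)
  have d3 := d1.mul d2
  have d4 : HasDerivAt (fun z : ℂ => (Real.pi : ℂ) / Complex.sin (Real.pi * z)) _ (1 / 4) :=
    (hasDerivAt_const (1 / 4 : ℂ) (Real.pi : ℂ)).div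
      ((hasDerivAt_id (1 / 4 : ℂ)).const_mul (Real.pi : ℂ)).csin hs
  have e : (Complex.Gamma * fun z : ℂ => Complex.Gamma (1 - z))
      = fun z : ℂ => (Real.pi : ℂ) / Complex.sin (Real.pi * z) := by
    funext z
    exact Complex.Gamma_mul_Gamma_one_sub z
  rw [e] at d3
  have key := d3.unique d4
  have hval := Complex.Gamma_mul_Gamma_one_sub (1 / 4)
  have g1 := Complex.Gamma_ne_zero_of_re_pos h14
  have g2 := Complex.Gamma_ne_zero_of_re_pos h34
  have e34 : (3 / 4 : ℂ) = 1 - 1 / 4 := by norm_num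
  rw [e34, Complex.digamma_def, logDeriv_apply, logDeriv_apply]
  simp only [id] at key
  rw [hc] at key
  generalize Complex.Gamma (1 - 1 / 4) = A at *
  generalize Complex.Gamma (1 / 4) = B at *
  generalize deriv Complex.Gamma (1 - 1 / 4) = A' at *
  generalize deriv Complex.Gamma (1 / 4) = B' at *
  generalize Complex.sin (Real.pi * (1 / 4)) = S at *
  have hABS : B * A * S = Real.pi := by rw [hval]; field_simp
  have hk : B' * A - B * A' = - (Real.pi : ℂ) * (B * A) := by
    rw [hval]
    have : B' * A + B * (A' * -1) = _ := key
    field_simp at this ⊢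
    linear_combination this
  field_simp
  linear_combination -hk

/-- Raising `j` by one moves both arguments by `1/2`: the new lower argument is the old upper one,
and the new upper argument is the old lower one plus `1`. Hence `ψ(z+1) = ψ(z) + 1/z` yields the
recursion of `arctanMoment_add_succ`, up to the factor `4`. -/
theorem digamma_sub_digamma (j : ℕ) :
    Complex.digamma ((2 * (j : ℂ) + 3) / 4) - Complex.digamma ((2 * (j : ℂ) + 1) / 4)
      = ((4 * arctanMoment j : ℝ) : ℂ) := by
  induction j with
  | zero =>
    have := digamma_three_quarters_sub_one_quarter
    rw [arctanMoment_zero]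
    simp only [Nat.cast_zero, mul_zero, zero_add]
    rw [this]
    push_cast
    ring
  | succ j ih =>
    have h0 : ∀ m : ℕ, (2 * (j : ℂ) + 1) / 4 ≠ -m := fun m h => by
      have := congrArg Complex.re h
      simp at this
      have h1 : (0 : ℝ) ≤ m := by positivity
      have h2 : (0 : ℝ) ≤ j := by positivity
      linarith
    have h1 := Complex.digamma_apply_add_one _ h0
    have e1 : (2 * ((j + 1 : ℕ) : ℂ) + 3) / 4 = (2 * (j : ℂ) + 1) / 4 + 1 := by push_cast; ring
    have e2 : (2 * ((j + 1 : ℕ) : ℂ) + 1) / 4 = (2 * (j : ℂ) + 3) / 4 := by push_cast; ring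
    have h2 : arctanMoment (j + 1) = 1 / (2 * (j : ℝ) + 1) - arctanMoment j := by
      linarith [arctanMoment_add_succ j]
    rw [e1, e2, h1, h2]
    push_cast at ih ⊢
    rw [inv_div]
    linear_combination -ih

theorem digammaTerm_eq (n k : ℕ) :
    digammaTerm n k = ((arctanMoment (k + n + 1) / (k : ℝ) ^ 2 : ℝ) : ℂ) := by
  have h := digamma_sub_digamma (k + n + 1)
  have e1 : (2 * ((k + n + 1 : ℕ) : ℂ) + 3) / 4 = (2 * (k : ℂ) + 2 * (n : ℂ) + 5) / 4 := by
    push_cast; ring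
  have e2 : (2 * ((k + n + 1 : ℕ) : ℂ) + 1) / 4 = (2 * (k : ℂ) + 2 * (n : ℂ) + 3) / 4 := by
    push_cast; ring
  rw [e1, e2] at h
  rw [digammaTerm, h]
  push_cast
  rw [mul_pow]
  norm_num
  rw [mul_div_mul_left _ _ (by norm_num : (4 : ℂ) ≠ 0)]

/-! ### Harmonic numbers and the series `∑ 1/(k²(2k+2n+1))`. -/

theorem sum_range_two_div_odd (m : ℕ) :
    ∑ i ∈ Finset.range m, 2 / (2 * (i : ℝ) + 1)
      = 2 * (harmonic (2 * m) : ℝ) - (harmonic m : ℝ) := by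
  induction m with
  | zero => simp
  | succ m ih =>
    rw [Finset.sum_range_succ, ih, show 2 * (m + 1) = 2 * m + 1 + 1 by ring, harmonic_succ,
      harmonic_succ, harmonic_succ]
    push_cast
    field_simp
    ring

theorem two_mul_harmonic_sub_harmonic_succ (n : ℕ) :
    2 * (harmonic (2 * (n + 1)) : ℝ) - (harmonic (n + 1) : ℝ)
      = 2 * (harmonic (2 * n + 1) : ℝ) - (harmonic n : ℝ) := by
  rw [show 2 * (n + 1) = 2 * n + 1 + 1 by ring, harmonic_succ (2 * n + 1), harmonic_succ n]
  push_cast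
  field_simp
  ring

/-- Insert `H_N = log N + γ + o(1)`: the constants `γ` cancel, and the logarithms combine to `log
(N/(N+M)) - 2 log 2`. -/
theorem tendsto_harmonic_add_harmonic_sub (M : ℕ) :
    Filter.Tendsto (fun N : ℕ => (harmonic N : ℝ) + (harmonic (N + M) : ℝ)
      - 2 * (harmonic (2 * (N + M)) : ℝ)) Filter.atTop (nhds (-2 * Real.log 2)) := by
  have h := Real.tendsto_harmonic_sub_log
  have h1 := h.comp (Filter.tendsto_add_atTop_nat M)
  have h2 := h.comp ((Filter.tendsto_id.const_mul_atTop' (by norm_num : 0 < 2)).comp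
    (Filter.tendsto_add_atTop_nat M))
  have h3 : Filter.Tendsto (fun N : ℕ => Real.log ((N : ℝ) / ((N : ℝ) + M)))
      Filter.atTop (nhds 0) := by
    have := (tendsto_natCast_div_add_atTop (𝕜 := ℝ) (M : ℝ)).log one_ne_zero
    simpa using this
  have h4 := (((h.add h1).sub (h2.const_mul 2)).add h3).sub_const (2 * Real.log 2)
  have e : Real.eulerMascheroniConstant + Real.eulerMascheroniConstant
      - 2 * Real.eulerMascheroniConstant + 0 - 2 * Real.log 2 = -2 * Real.log 2 := by ring
  rw [e] at h4
  refine h4.congr' ?_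
  filter_upwards [Filter.eventually_gt_atTop 0] with N hN
  have hN' : (N : ℝ) ≠ 0 := by positivity
  have hM' : (N : ℝ) + M ≠ 0 := by positivity
  simp only [Function.comp_apply, id]
  push_cast
  rw [Real.log_mul (by norm_num) hM', Real.log_div hN' hM']
  ring

theorem hasSum_inv_sub_two_div (n : ℕ) :
    HasSum (fun k : ℕ => 1 / ((k : ℝ) + 1) - 2 / (2 * ((k : ℝ) + 1) + 2 * n + 1))
      (2 * (harmonic (2 * n + 1) : ℝ) - (harmonic n : ℝ) - 2 * Real.log 2) := by
  rw [hasSum_iff_tendsto_nat_of_nonneg]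
  · have h := (tendsto_harmonic_add_harmonic_sub (n + 1)).add_const
      (2 * (harmonic (2 * n + 1) : ℝ) - (harmonic n : ℝ))
    refine (h.congr fun N => ?_).trans_eq (by ring_nf)
    -- Split this sum of `2/(2i+1)` after its first `n+1` terms. The remaining `N` terms are exactly
    -- the fractions subtracted in the series.
    have h1 := sum_range_two_div_odd (N + (n + 1))
    rw [add_comm N, Finset.sum_range_add, sum_range_two_div_odd,
      two_mul_harmonic_sub_harmonic_succ] at h1
    have h2 : (harmonic N : ℝ) = ∑ k ∈ Finset.range N, 1 / ((k : ℝ) + 1) := by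
      simp [harmonic]
    have h3 : ∑ x ∈ Finset.range N, 2 / (2 * ((n + 1 + x : ℕ) : ℝ) + 1)
        = ∑ k ∈ Finset.range N, 2 / (2 * ((k : ℝ) + 1) + 2 * n + 1) := by
      refine Finset.sum_congr rfl fun k _ => ?_
      push_cast
      ring_nf
    rw [h3, add_comm (n + 1)] at h1
    rw [Finset.sum_sub_distrib, ← h2]
    linarith
  · intro k
    rw [div_sub_div _ _ (by positivity) (by positivity)]
    refine div_nonneg ?_ (by positivity)
    have : (0 : ℝ) ≤ n := by positivity
    linarith

/-- The value of `∑_{k ≥ 1} 1 / (k² (2k + 2n + 1))`. -/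
noncomputable def invSqOddSum (n : ℕ) : ℝ :=
  Real.pi ^ 2 / (6 * (2 * n + 1))
    - 2 / (2 * (n : ℝ) + 1) ^ 2
      * (2 * (harmonic (2 * n + 1) : ℝ) - (harmonic n : ℝ) - 2 * Real.log 2)

theorem hasSum_inv_sq_succ :
    HasSum (fun k : ℕ => 1 / ((k : ℝ) + 1) ^ 2) (Real.pi ^ 2 / 6) := by
  have := (hasSum_nat_add_iff' 1).2 hasSum_zeta_two
  simpa using this

/-- With `c = 2n+1`, partial fractions give `1/(k²(2k+c)) = 1/(c k²) - (2/c²)(1/k - 2/(2k+c))`. -/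
theorem hasSum_invSqOddSum (n : ℕ) :
    HasSum (fun k : ℕ => 1 / (((k : ℝ) + 1) ^ 2 * (2 * ((k : ℝ) + 1) + 2 * n + 1)))
      (invSqOddSum n) := by
  have h := (hasSum_inv_sq_succ.mul_left (1 / (2 * (n : ℝ) + 1))).sub
    ((hasSum_inv_sub_two_div n).mul_left (2 / (2 * (n : ℝ) + 1) ^ 2))
  convert! h using 1
  · funext k
    field_simp
    ring
  · rw [invSqOddSum]
    field_simp

/-! ### The recursion in `n` and its solution for each parity. -/

/-- The sequence of values of the series, from the value `J` of
`∑_{k ≥ 1} arctanMoment k / k²`. -/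
noncomputable def thetaSeq (J : ℝ) : ℕ → ℝ
  | 0 => invSqOddSum 0 - J
  | n + 1 => invSqOddSum (n + 1) - thetaSeq J n

theorem hasSum_arctanMoment_shift {J : ℝ}
    (hJ : HasSum (fun k : ℕ => arctanMoment (k + 1) / ((k : ℝ) + 1) ^ 2) J) (n : ℕ) :
    HasSum (fun k : ℕ => arctanMoment (k + 1 + n + 1) / ((k : ℝ) + 1) ^ 2) (thetaSeq J n) := by
  induction n with
  | zero =>
    refine ((hasSum_invSqOddSum 0).sub hJ).congr_fun fun k => ?_
    have h := arctanMoment_add_succ (k + 1)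
    rw [add_zero, eq_sub_of_add_eq' h]
    push_cast
    field_simp
    ring
  | succ n ih =>
    refine ((hasSum_invSqOddSum (n + 1)).sub ih).congr_fun fun k => ?_
    have h := arctanMoment_add_succ (k + 1 + n + 1)
    rw [← add_assoc (k + 1), eq_sub_of_add_eq' h]
    push_cast
    field_simp
    ring

theorem hasSum_digammaTerm {J : ℝ}
    (hJ : HasSum (fun k : ℕ => arctanMoment (k + 1) / ((k : ℝ) + 1) ^ 2) J) (n : ℕ) :
    HasSum (fun k : ℕ => digammaTerm n (k + 1)) ((thetaSeq J n : ℝ) : ℂ) := by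
  have h := Complex.hasSum_ofReal.2 (hasSum_arctanMoment_shift hJ n)
  refine h.congr_fun fun k => ?_
  rw [digammaTerm_eq]
  push_cast
  rfl

theorem thetaSeq_add_two (J : ℝ) (n : ℕ) :
    thetaSeq J (n + 2) = thetaSeq J n + (invSqOddSum (n + 2) - invSqOddSum (n + 1)) := by
  simp only [thetaSeq]
  ring

/-- Two steps of the recursion add `invSqOddSum (2m+2) - invSqOddSum (2m+1)`. Lowering `2H_(4m+5) -
H_(2m+2)` to `2H_(4m+3) - H_(2m+1)` costs only `2/(4m+5)`, the source of the cubes; the common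
bracket then carries `2/(4m+3)² - 2/(4m+5)² = 32(m+1)/((4m+5)²(4m+3)²)`. -/
theorem thetaSeq_even (J : ℝ) (m : ℕ) :
    thetaSeq J (2 * m) = -4
      + 32 * ∑ j ∈ Finset.range m,
          ((j : ℝ) + 1) * (2 * (harmonic (4 * j + 3) : ℝ) - (harmonic (2 * j + 1) : ℝ))
            / ((4 * (j : ℝ) + 5) ^ 2 * (4 * (j : ℝ) + 3) ^ 2)
      - 4 * ∑ j ∈ Finset.range m, 1 / (4 * (j : ℝ) + 5) ^ 3
      + Real.pi ^ 2 * (1 / 6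
          - 1 / 3 * ∑ j ∈ Finset.range m, 1 / ((4 * (j : ℝ) + 5) * (4 * (j : ℝ) + 3)))
      + Real.log 2 * (4
          - 64 * ∑ j ∈ Finset.range m,
              ((j : ℝ) + 1) / ((4 * (j : ℝ) + 5) ^ 2 * (4 * (j : ℝ) + 3) ^ 2))
      - J := by
  induction m with
  | zero =>
    simp [thetaSeq, invSqOddSum, harmonic_succ]
    ring
  | succ m ih =>
    rw [show 2 * (m + 1) = 2 * m + 2 by ring, thetaSeq_add_two, ih]
    simp only [Finset.sum_range_succ, invSqOddSum]
    rw [show 2 * (2 * m + 2) + 1 = 4 * m + 3 + 1 + 1 by ring,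
      show 2 * (2 * m + 1) + 1 = 4 * m + 3 by ring, show 2 * m + 2 = 2 * m + 1 + 1 by ring,
      harmonic_succ (4 * m + 3 + 1), harmonic_succ (4 * m + 3), harmonic_succ (2 * m + 1)]
    push_cast
    generalize (harmonic (4 * m + 3) : ℝ) = A
    generalize (harmonic (2 * m + 1) : ℝ) = B
    field_simp
    ring

theorem thetaSeq_odd (J : ℝ) (m : ℕ) :
    thetaSeq J (2 * m + 1) = 92 / 27
      + 16 * ∑ j ∈ Finset.Icc 1 m,
          (2 * (j : ℝ) + 1) * (2 * (harmonic (4 * j + 1) : ℝ) - (harmonic (2 * j) : ℝ))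
            / ((4 * (j : ℝ) + 3) ^ 2 * (4 * (j : ℝ) + 1) ^ 2)
      - 4 * ∑ j ∈ Finset.Icc 1 m, 1 / (4 * (j : ℝ) + 3) ^ 3
      - Real.pi ^ 2 * (1 / 9
          + 1 / 3 * ∑ j ∈ Finset.Icc 1 m, 1 / ((4 * (j : ℝ) + 3) * (4 * (j : ℝ) + 1)))
      - Real.log 2 * (32 / 9
          + 32 * ∑ j ∈ Finset.Icc 1 m,
              (2 * (j : ℝ) + 1) / ((4 * (j : ℝ) + 3) ^ 2 * (4 * (j : ℝ) + 1) ^ 2))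
      + J := by
  induction m with
  | zero =>
    simp [thetaSeq, invSqOddSum, harmonic_succ]
    ring
  | succ m ih =>
    rw [show 2 * (m + 1) + 1 = 2 * m + 1 + 2 by ring, thetaSeq_add_two, ih]
    simp only [Finset.sum_Icc_succ_top (Nat.le_add_left 1 m), invSqOddSum]
    rw [show 2 * (2 * m + 1 + 2) + 1 = 4 * (m + 1) + 1 + 1 + 1 by ring,
      show 2 * (2 * m + 1 + 1) + 1 = 4 * (m + 1) + 1 by ring,
      show 2 * m + 1 + 2 = 2 * (m + 1) + 1 by ring, show 2 * m + 1 + 1 = 2 * (m + 1) by ring,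
      harmonic_succ (4 * (m + 1) + 1 + 1), harmonic_succ (4 * (m + 1) + 1),
      harmonic_succ (2 * (m + 1))]
    push_cast
    generalize (harmonic (4 * (m + 1) + 1) : ℝ) = A
    generalize (harmonic (2 * (m + 1)) : ℝ) = B
    field_simp
    ring_nf

/-! ### Reduction of `J` to an integral of `arctan x · log(1-x²)/x`. -/

theorem arctanMoment_nonneg (j : ℕ) : 0 ≤ arctanMoment j :=
  intervalIntegral.integral_nonneg zero_le_one fun x hx => by
    have := hx.1
    positivity

/-- Integration by parts with `1/(1+x²) = arctan' x`. The factor `k+1` that it produces cancels one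
power in `1/(k+1)²`, so the sum over `k` becomes a logarithmic series. -/
theorem arctanMoment_succ_eq (k : ℕ) :
    arctanMoment (k + 1)
      = Real.pi / 4 - 2 * ((k : ℝ) + 1) * ∫ x in (0 : ℝ)..1, Real.arctan x * x ^ (2 * k + 1) := by
  have hF : ∀ x ∈ Set.uIcc (0 : ℝ) 1, HasDerivAt (fun x => Real.arctan x * x ^ (2 * k + 2))
      (x ^ (2 * (k + 1)) / (1 + x ^ 2)
        + 2 * ((k : ℝ) + 1) * (Real.arctan x * x ^ (2 * k + 1))) x := by
    intro x _
    refine ((Real.hasDerivAt_arctan x).mul (hasDerivAt_pow (2 * k + 2) x)).congr_deriv ?_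
    rw [show 2 * k + 2 - 1 = 2 * k + 1 from rfl]
    push_cast
    ring
  have i1 := (continuous_pow_div_one_add_sq (2 * (k + 1))).intervalIntegrable
    (μ := MeasureTheory.volume) 0 1
  have i2 : IntervalIntegrable (fun x : ℝ => Real.arctan x * x ^ (2 * k + 1))
      MeasureTheory.volume 0 1 :=
    Continuous.intervalIntegrable (by fun_prop) _ _
  have h := intervalIntegral.integral_eq_sub_of_hasDerivAt hF (i1.add (i2.const_mul _))
  rw [intervalIntegral.integral_add i1 (i2.const_mul _), intervalIntegral.integral_const_mul] at h
  simp only [Real.arctan_one, one_pow, mul_one, Real.arctan_zero, zero_mul, sub_zero] at h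
  rw [arctanMoment]
  linarith

theorem hasSum_integral_arctan_mul_pow :
    HasSum (fun k : ℕ => (∫ x in (0 : ℝ)..1, Real.arctan x * x ^ (2 * k + 1)) / ((k : ℝ) + 1))
      (-∫ x in (0 : ℝ)..1, Real.arctan x * Real.log (1 - x ^ 2) / x) := by
  set f : ℕ → ℝ → ℝ := fun k x => Real.arctan x * x ^ (2 * k + 1) / ((k : ℝ) + 1) with hf
  have hint : ∀ k, MeasureTheory.Integrable (f k)
      (MeasureTheory.volume.restrict (Set.Ioc (0 : ℝ) 1)) := fun k =>
    (intervalIntegrable_iff_integrableOn_Ioc_of_le zero_le_one).1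
      (Continuous.intervalIntegrable (by fun_prop) _ _)
  have hval : ∀ k, ∫ x in Set.Ioc (0 : ℝ) 1, f k x
      = (∫ x in (0 : ℝ)..1, Real.arctan x * x ^ (2 * k + 1)) / ((k : ℝ) + 1) := fun k => by
    rw [← intervalIntegral.integral_of_le zero_le_one, ← intervalIntegral.integral_div]
  have hnorm : ∀ k, ∫ x in Set.Ioc (0 : ℝ) 1, ‖f k x‖ = ∫ x in Set.Ioc (0 : ℝ) 1, f k x := by
    intro k
    refine MeasureTheory.setIntegral_congr_fun measurableSet_Ioc fun x hx => ?_
    have h1 : 0 < x := hx.1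
    have h2 : 0 ≤ Real.arctan x := Real.arctan_nonneg.2 h1.le
    exact Real.norm_of_nonneg (by positivity)
  have hsum : Summable fun k => ∫ x in Set.Ioc (0 : ℝ) 1, ‖f k x‖ := by
    simp only [hnorm]
    refine Summable.of_nonneg_of_le (fun k => ?_) (fun k => ?_)
      (hasSum_inv_sq_succ.summable.mul_left (Real.pi / 8))
    · rw [← hnorm]
      exact MeasureTheory.integral_nonneg fun _ => norm_nonneg _
    -- Nonnegativity of the moment turns the integration by parts into `∫ arctan x · x^(2k+1) ≤
    -- π/(8(k+1))`.
    · have h := arctanMoment_succ_eq k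
      have h0 := arctanMoment_nonneg (k + 1)
      rw [hval]
      have hk : (0 : ℝ) < (k : ℝ) + 1 := by positivity
      rw [mul_one_div, div_le_div_iff₀ hk (by positivity)]
      nlinarith
  have key := MeasureTheory.hasSum_integral_of_summable_integral_norm hint hsum
  simp only [hval] at key
  convert! key using 1
  rw [← intervalIntegral.integral_neg, intervalIntegral.integral_of_le zero_le_one,
    MeasureTheory.integral_Ioc_eq_integral_Ioo, MeasureTheory.integral_Ioc_eq_integral_Ioo]
  refine MeasureTheory.setIntegral_congr_fun measurableSet_Ioo fun x hx => ?_
  have hx0 : x ≠ 0 := hx.1.ne'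
  have hlt : |x ^ 2| < 1 := by
    rw [abs_of_nonneg (by positivity)]
    nlinarith [hx.1, hx.2]
  have h := (Real.hasSum_pow_div_log_of_abs_lt_one hlt).mul_left (Real.arctan x / x)
  have e : (fun k : ℕ => f k x)
      = fun k : ℕ => Real.arctan x / x * ((x ^ 2) ^ (k + 1) / ((k : ℝ) + 1)) := by
    funext k
    simp only [hf]
    field_simp
    ring
  simp only [e, h.tsum_eq]
  ring

theorem hasSum_arctanMoment_div_sq :
    HasSum (fun k : ℕ => arctanMoment (k + 1) / ((k : ℝ) + 1) ^ 2)
      (Real.pi ^ 3 / 24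
        + 2 * ∫ x in (0 : ℝ)..1, Real.arctan x * Real.log (1 - x ^ 2) / x) := by
  have h := (hasSum_inv_sq_succ.mul_left (Real.pi / 4)).sub
    (hasSum_integral_arctan_mul_pow.mul_left 2)
  convert! h using 1
  · funext k
    rw [arctanMoment_succ_eq]
    field_simp
  · ring

/-! ### Path independence for functions with a logarithmic singularity at the origin. -/

/-- A bounded convex open sector with vertex at the origin, in the right half-plane. -/
def logSector : Set ℂ := {z : ℂ | |z.im| < 2 * z.re} ∩ Metric.ball 2 2

theorem isOpen_logSector : IsOpen logSector :=
  (isOpen_lt (by fun_prop) (by fun_prop)).inter Metric.isOpen_ball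

theorem re_pos_of_mem_logSector {z : ℂ} (hz : z ∈ logSector) : 0 < z.re := by
  have h : |z.im| < 2 * z.re := hz.1
  linarith [abs_nonneg z.im]

theorem mem_slitPlane_of_mem_logSector {z : ℂ} (hz : z ∈ logSector) : z ∈ Complex.slitPlane :=
  Or.inl (re_pos_of_mem_logSector hz)

theorem ne_zero_of_mem_logSector {z : ℂ} (hz : z ∈ logSector) : z ≠ 0 :=
  Complex.slitPlane_ne_zero (mem_slitPlane_of_mem_logSector hz)

theorem mem_ball_two_iff {z : ℂ} :
    z ∈ Metric.ball (2 : ℂ) 2 ↔ z.re ^ 2 + z.im ^ 2 < 4 * z.re := by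
  rw [mem_ball_iff_norm, ← sq_lt_sq₀ (norm_nonneg _) (by norm_num), Complex.sq_norm,
    Complex.normSq_apply]
  simp only [Complex.sub_re, Complex.sub_im, Complex.re_ofNat, Complex.im_ofNat]
  constructor <;> intro h <;> nlinarith

theorem convex_logSector : Convex ℝ logSector := by
  refine Convex.inter ?_ (convex_ball _ _)
  intro z hz w hw a b ha hb hab
  have hz' : |z.im| < 2 * z.re := hz
  have hw' : |w.im| < 2 * w.re := hw
  rw [abs_lt] at hz' hw'
  change |(a • z + b • w).im| < 2 * (a • z + b • w).re
  simp only [Complex.add_im, Complex.add_re, Complex.smul_re, Complex.smul_im, smul_eq_mul]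
  rw [abs_lt]
  rcases ha.eq_or_lt with rfl | ha'
  · obtain rfl : b = 1 := by linarith
    constructor <;> linarith [hz'.1, hz'.2, hw'.1, hw'.2]
  · constructor <;> nlinarith [mul_pos ha' (sub_pos.2 hz'.1), mul_pos ha' (sub_pos.2 hz'.2),
      mul_nonneg hb (sub_pos.2 hw'.1).le, mul_nonneg hb (sub_pos.2 hw'.2).le]

theorem ofReal_mul_mem_logSector {z : ℂ} (hz : z ∈ logSector) {t : ℝ} (ht0 : 0 < t)
    (ht1 : t ≤ 1) : (t : ℂ) * z ∈ logSector := by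
  have h0 := re_pos_of_mem_logSector hz
  obtain ⟨h1, h2⟩ := hz
  refine ⟨?_, ?_⟩
  · change |((t : ℂ) * z).im| < 2 * ((t : ℂ) * z).re
    have h1' : |z.im| < 2 * z.re := h1
    simp only [Complex.re_ofReal_mul, Complex.im_ofReal_mul, abs_mul, abs_of_pos ht0]
    nlinarith
  · rw [mem_ball_two_iff] at h2 ⊢
    simp only [Complex.re_ofReal_mul, Complex.im_ofReal_mul]
    have h3 : t * (z.re ^ 2 + z.im ^ 2) ≤ z.re ^ 2 + z.im ^ 2 :=
      mul_le_of_le_one_left (by positivity) ht1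
    nlinarith

theorem intervalIntegrable_log_sq :
    IntervalIntegrable (fun t => Real.log t ^ 2) MeasureTheory.volume 0 1 := by
  simpa using (integral_pow_mul_log_sq 0).1

theorem intervalIntegrable_one_add_abs_log_sq :
    IntervalIntegrable (fun t => (1 + |Real.log t|) ^ 2) MeasureTheory.volume 0 1 := by
  have h := ((intervalIntegrable_const (c := (1 : ℝ)) (μ := MeasureTheory.volume)
    (a := (0 : ℝ)) (b := 1)).add
      (intervalIntegral.intervalIntegrable_log'.abs.const_mul 2)).add intervalIntegrable_log_sq
  refine h.congr fun t _ => ?_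
  rw [add_sq, sq_abs]
  ring

/-- Since `log x = 2 log √x`, the function is the square of `K√x + 2|√x log √x|`, and `y log y` is
continuous at `0`. -/
theorem tendsto_mul_add_abs_log_sq (K : ℝ) :
    Filter.Tendsto (fun x : ℝ => x * (K + |Real.log x|) ^ 2) (nhdsWithin 0 (Set.Ioi 0))
      (nhds 0) := by
  have hc : Continuous fun x : ℝ => (K * √x + 2 * |√x * Real.log (√x)|) ^ 2 :=
    ((continuous_const.mul Real.continuous_sqrt).add
      (continuous_const.mul (Real.continuous_mul_log.comp Real.continuous_sqrt).abs)).pow 2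
  have h := hc.tendsto 0
  simp only [Real.sqrt_zero, mul_zero, zero_mul, abs_zero, add_zero, ne_eq, OfNat.ofNat_ne_zero,
    not_false_eq_true, zero_pow] at h
  refine (h.mono_left nhdsWithin_le_nhds).congr' ?_
  filter_upwards [self_mem_nhdsWithin] with x hx
  have hx0 : (0 : ℝ) < x := hx
  have hs : 0 < √x := Real.sqrt_pos.2 hx0
  rw [abs_mul, abs_of_pos hs, Real.log_sqrt hx0.le, abs_div, abs_two]
  have h2 : √x ^ 2 = x := Real.sq_sqrt hx0.le
  calc (K * √x + 2 * (√x * (|Real.log x| / 2))) ^ 2 = √x ^ 2 * (K + |Real.log x|) ^ 2 := by ring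
    _ = x * (K + |Real.log x|) ^ 2 := by rw [h2]

/-- The integral of `φ` along the segment from `0` to `z`. -/
noncomputable def rayIntegral (φ : ℂ → ℂ) (z : ℂ) : ℂ :=
  ∫ t in (0 : ℝ)..1, z * φ (t * z)

/-- `φ` is holomorphic on `logSector` with at most a squared logarithmic singularity at `0`. -/
structure IsLogBounded (φ : ℂ → ℂ) (C : ℝ) : Prop where
  nonneg : 0 ≤ C
  differentiableOn : DifferentiableOn ℂ φ (Metric.ball 2 2)
  bound : ∀ z ∈ logSector, ‖φ z‖ ≤ C * (1 + ‖Complex.log z‖) ^ 2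

namespace IsLogBounded

variable {φ : ℂ → ℂ} {C : ℝ}

/-- From `log (t z) = log t + log z` and `1 + |a+b| ≤ (1+|a|)(1+|b|)`: the dependence on `t`
separates into a fixed integrable factor. -/
theorem norm_ofReal_mul_le (h : IsLogBounded φ C) {z : ℂ} (hz : z ∈ logSector) {t : ℝ}
    (ht0 : 0 < t) (ht1 : t ≤ 1) :
    ‖φ (t * z)‖ ≤ C * (1 + ‖Complex.log z‖) ^ 2 * (1 + |Real.log t|) ^ 2 := by
  refine (h.bound _ (ofReal_mul_mem_logSector hz ht0 ht1)).trans ?_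
  rw [mul_assoc, ← mul_pow]
  refine mul_le_mul_of_nonneg_left (pow_le_pow_left₀ (by positivity) ?_ 2) h.nonneg
  rw [Complex.log_ofReal_mul ht0 (ne_zero_of_mem_logSector hz)]
  have h1 := norm_add_le ((Real.log t : ℝ) : ℂ) (Complex.log z)
  rw [Complex.norm_real, Real.norm_eq_abs] at h1
  nlinarith [mul_nonneg (norm_nonneg (Complex.log z)) (abs_nonneg (Real.log t))]

theorem intervalIntegrable_ray (h : IsLogBounded φ C) {z : ℂ} (hz : z ∈ logSector) :
    IntervalIntegrable (fun t : ℝ => z * φ (t * z)) MeasureTheory.volume 0 1 := by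
  refine (intervalIntegrable_one_add_abs_log_sq.const_mul
    (‖z‖ * (C * (1 + ‖Complex.log z‖) ^ 2))).mono_fun ?_ ?_
  · rw [Set.uIoc_of_le zero_le_one]
    refine ContinuousOn.aestronglyMeasurable ?_ measurableSet_Ioc
    refine continuousOn_const.mul (h.differentiableOn.continuousOn.comp (by fun_prop) ?_)
    exact fun t ht => (ofReal_mul_mem_logSector hz ht.1 ht.2).2
  · refine (MeasureTheory.ae_restrict_iff' measurableSet_uIoc).2
      (Filter.Eventually.of_forall fun t ht => ?_)
    rw [Set.uIoc_of_le zero_le_one] at ht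
    have h0 := h.nonneg
    simp only
    rw [norm_mul, Real.norm_of_nonneg (by positivity), mul_assoc]
    exact mul_le_mul_of_nonneg_left (h.norm_ofReal_mul_le hz ht.1 ht.2) (norm_nonneg _)

theorem norm_rayIntegral_le (h : IsLogBounded φ C) {z : ℂ} (hz : z ∈ logSector) :
    ‖rayIntegral φ z‖ ≤ C * (∫ t in (0 : ℝ)..1, (1 + |Real.log t|) ^ 2)
      * (‖z‖ * (1 + ‖Complex.log z‖) ^ 2) := by
  refine (intervalIntegral.norm_integral_le_of_norm_le
    (g := fun t => ‖z‖ * (C * (1 + ‖Complex.log z‖) ^ 2) * (1 + |Real.log t|) ^ 2) zero_le_one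
    (Filter.Eventually.of_forall fun t ht => ?_)
    (intervalIntegrable_one_add_abs_log_sq.const_mul _)).trans_eq ?_
  · rw [norm_mul, mul_assoc]
    exact mul_le_mul_of_nonneg_left (h.norm_ofReal_mul_le hz ht.1 ht.2) (norm_nonneg _)
  · rw [intervalIntegral.integral_const_mul]
    ring

/-- This is Cauchy's theorem on the triangle `0, z, w`, whose vertex `0` lies on the boundary of the
domain. Only the difference `Φ(tz) - Φ(tw)` is followed to `t = 0`, so no boundary value of `Φ` is
needed. -/
theorem rayIntegral_sub (h : IsLogBounded φ C) {Φ : ℂ → ℂ}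
    (hΦ : ∀ z ∈ Metric.ball (2 : ℂ) 2, HasDerivAt Φ (φ z) z) {z w : ℂ}
    (hz : z ∈ logSector) (hw : w ∈ logSector) :
    rayIntegral φ z - rayIntegral φ w = Φ z - Φ w := by
  have hderiv : ∀ v ∈ logSector, ∀ t ∈ Set.Ioc (0 : ℝ) 1,
      HasDerivAt (fun t : ℝ => Φ (t * v)) (v * φ (t * v)) t := by
    intro v hv t ht
    have h1 := hΦ _ (ofReal_mul_mem_logSector hv ht.1 ht.2).2
    have h2 : HasDerivAt (fun t : ℝ => (t : ℂ) * v) v t := by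
      simpa using (Complex.ofRealCLM.hasDerivAt (x := t)).mul_const v
    rw [mul_comm v]
    exact HasDerivAt.comp (h₂ := Φ) (h := fun t : ℝ => (t : ℂ) * v) t h1 h2
  have hseg : segment ℝ z w ⊆ logSector := convex_logSector.segment_subset hz hw
  obtain ⟨M, hM⟩ : ∃ M, ∀ v ∈ segment ℝ z w, ‖Complex.log v‖ ≤ M := by
    have hcomp : IsCompact (segment ℝ z w) := by
      rw [segment_eq_image]
      exact isCompact_Icc.image (by fun_prop)
    exact hcomp.exists_bound_of_continuousOn fun v hv =>
      (Complex.differentiableAt_log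
        (mem_slitPlane_of_mem_logSector (hseg hv))).continuousAt.continuousWithinAt
  -- The scaled segment has length `t‖z - w‖`, while `φ` grows on it only like `(1 + |log t|)²`.
  have hlim : Filter.Tendsto (fun t : ℝ => Φ (t * z) - Φ (t * w)) (nhdsWithin 0 (Set.Ioi 0))
      (nhds 0) := by
    have h0 := (tendsto_mul_add_abs_log_sq 1).const_mul (C * (1 + M) ^ 2 * ‖z - w‖)
    rw [mul_zero] at h0
    refine squeeze_zero_norm' ?_ h0
    filter_upwards [Ioo_mem_nhdsGT (zero_lt_one' ℝ)] with t ht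
    have hb := Convex.norm_image_sub_le_of_norm_hasDerivWithin_le
      (f := fun v : ℂ => Φ (t * v)) (f' := fun v => t * φ (t * v)) (s := segment ℝ z w)
      (C := t * (C * (1 + M) ^ 2 * (1 + |Real.log t|) ^ 2)) (x := w) (y := z) ?_ ?_
      (convex_segment _ _) (right_mem_segment ℝ _ _) (left_mem_segment ℝ _ _)
    · exact hb.trans_eq (by ring)
    · intro v hv
      have h1 := hΦ _ (ofReal_mul_mem_logSector (hseg hv) ht.1 ht.2.le).2
      have h2 : HasDerivAt (fun v : ℂ => (t : ℂ) * v) t v := by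
        simpa using (hasDerivAt_id v).const_mul (t : ℂ)
      have h3 := HasDerivAt.comp (h₂ := Φ) (h := fun v : ℂ => (t : ℂ) * v) v h1 h2
      rw [mul_comm] at h3
      exact h3.hasDerivWithinAt
    · intro v hv
      rw [norm_mul, Complex.norm_real, Real.norm_of_nonneg ht.1.le]
      refine mul_le_mul_of_nonneg_left
        ((h.norm_ofReal_mul_le (hseg hv) ht.1 ht.2.le).trans ?_) ht.1.le
      have h4 := h.nonneg
      have h5 := hM v hv
      gcongr
  have hz1 := hderiv z hz 1 ⟨one_pos, le_rfl⟩
  have hw1 := hderiv w hw 1 ⟨one_pos, le_rfl⟩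
  have hone := ((hz1.sub hw1).continuousAt.tendsto).mono_left
    (nhdsWithin_le_nhds (s := Set.Iio (1 : ℝ)))
  have key := intervalIntegral.integral_eq_sub_of_hasDerivAt_of_tendsto (zero_lt_one' ℝ)
    (f := fun t : ℝ => Φ (t * z) - Φ (t * w)) (f' := fun t : ℝ => z * φ (t * z) - w * φ (t * w))
    (fun t ht => (hderiv z hz t ⟨ht.1, ht.2.le⟩).sub (hderiv w hw t ⟨ht.1, ht.2.le⟩))
    ((h.intervalIntegrable_ray hz).sub (h.intervalIntegrable_ray hw)) hlim hone
  rw [intervalIntegral.integral_sub (h.intervalIntegrable_ray hz)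
    (h.intervalIntegrable_ray hw)] at key
  rw [rayIntegral, rayIntegral, key]
  simp

/-- A holomorphic function on a disc has a primitive there, and by `rayIntegral_sub` the ray
integral differs from it by a constant on the sector. -/
theorem hasDerivAt_rayIntegral (h : IsLogBounded φ C) {z : ℂ} (hz : z ∈ logSector) :
    HasDerivAt (rayIntegral φ) (φ z) z := by
  obtain ⟨Φ, hΦ⟩ := h.differentiableOn.isExactOn_ball
  refine ((hΦ z hz.2).add_const (rayIntegral φ z - Φ z)).congr_of_eventuallyEq ?_
  filter_upwards [isOpen_logSector.mem_nhds hz] with w hw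
  have := h.rayIntegral_sub hΦ hw hz
  linear_combination this

theorem tendsto_rayIntegral_zero (h : IsLogBounded φ C) {ι : Type*} {l : Filter ι} {u : ι → ℂ}
    (hu : Filter.Tendsto u l (nhds 0)) (hmem : ∀ᶠ i in l, u i ∈ logSector) :
    Filter.Tendsto (fun i => rayIntegral φ (u i)) l (nhds 0) := by
  have hn : Filter.Tendsto (fun i => ‖u i‖) l (nhdsWithin 0 (Set.Ioi 0)) := by
    refine tendsto_nhdsWithin_iff.2 ⟨by simpa using hu.norm, ?_⟩
    filter_upwards [hmem] with i hi
    exact norm_pos_iff.2 (ne_zero_of_mem_logSector hi)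
  have h0 := (((tendsto_mul_add_abs_log_sq (1 + Real.pi)).comp hn).const_mul
    (C * ∫ t in (0 : ℝ)..1, (1 + |Real.log t|) ^ 2))
  rw [mul_zero] at h0
  refine squeeze_zero_norm' ?_ h0
  filter_upwards [hmem] with i hi
  refine (h.norm_rayIntegral_le hi).trans ?_
  have hint : 0 ≤ ∫ t in (0 : ℝ)..1, (1 + |Real.log t|) ^ 2 :=
    intervalIntegral.integral_nonneg zero_le_one fun t _ => by positivity
  have hlog : ‖Complex.log (u i)‖ ≤ |Real.log ‖u i‖| + Real.pi := by
    refine (Complex.norm_le_abs_re_add_abs_im _).trans ?_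
    rw [Complex.log_re, Complex.log_im]
    exact add_le_add_right (Complex.abs_arg_le_pi _) _
  have h4 := h.nonneg
  simp only [Function.comp_apply]
  gcongr _ * (_ * ?_ ^ 2)
  linarith

/-- Endpoints enter only through limits, so the path may run into the singular point `0`. -/
theorem integral_path (h : IsLogBounded φ C) {u u' : ℝ → ℂ} {a b : ℂ}
    (hu : ∀ x ∈ Set.Ioo (0 : ℝ) 1, HasDerivAt u (u' x) x)
    (hmem : ∀ x ∈ Set.Ioo (0 : ℝ) 1, u x ∈ logSector)
    (hint : IntervalIntegrable (fun x => φ (u x) * u' x) MeasureTheory.volume 0 1)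
    (ha : Filter.Tendsto (fun x => rayIntegral φ (u x)) (nhdsWithin 0 (Set.Ioi 0)) (nhds a))
    (hb : Filter.Tendsto (fun x => rayIntegral φ (u x)) (nhdsWithin 1 (Set.Iio 1)) (nhds b)) :
    ∫ x in (0 : ℝ)..1, φ (u x) * u' x = b - a :=
  intervalIntegral.integral_eq_sub_of_hasDerivAt_of_tendsto (zero_lt_one' ℝ)
    (fun x hx => (h.hasDerivAt_rayIntegral (hmem x hx)).comp x (hu x hx)) hint ha hb

theorem intervalIntegrable_path (h : IsLogBounded φ C) {u u' : ℝ → ℂ}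
    (hu : ∀ x ∈ Set.Icc (0 : ℝ) 1, HasDerivAt u (u' x) x)
    (hu' : ContinuousOn u' (Set.Icc 0 1))
    (hmem : ∀ x ∈ Set.Icc (0 : ℝ) 1, u x ∈ logSector) :
    IntervalIntegrable (fun x => φ (u x) * u' x) MeasureTheory.volume 0 1 := by
  have hcont : ContinuousOn u (Set.Icc 0 1) := fun x hx =>
    (hu x hx).continuousAt.continuousWithinAt
  refine ContinuousOn.intervalIntegrable ?_
  rw [Set.uIcc_of_le zero_le_one]
  exact (h.differentiableOn.continuousOn.comp hcont fun x hx => (hmem x hx).2).mul hu'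

/-- The integral along a path in `logSector` is the difference of the integrals along the
segments from the origin. -/
theorem integral_path_of_contDiff (h : IsLogBounded φ C) {u u' : ℝ → ℂ}
    (hu : ∀ x ∈ Set.Icc (0 : ℝ) 1, HasDerivAt u (u' x) x)
    (hu' : ContinuousOn u' (Set.Icc 0 1))
    (hmem : ∀ x ∈ Set.Icc (0 : ℝ) 1, u x ∈ logSector) :
    ∫ x in (0 : ℝ)..1, φ (u x) * u' x = rayIntegral φ (u 1) - rayIntegral φ (u 0) := by
  have hW : ∀ x ∈ Set.Icc (0 : ℝ) 1, ContinuousAt (fun x => rayIntegral φ (u x)) x := fun x hx =>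
    ContinuousAt.comp (g := rayIntegral φ) (f := u)
      (h.hasDerivAt_rayIntegral (hmem x hx)).continuousAt (hu x hx).continuousAt
  exact h.integral_path (fun x hx => hu x (Set.Ioo_subset_Icc_self hx))
    (fun x hx => hmem x (Set.Ioo_subset_Icc_self hx)) (h.intervalIntegrable_path hu hu' hmem)
    ((hW 0 (by simp)).tendsto.mono_left nhdsWithin_le_nhds)
    ((hW 1 (by simp)).tendsto.mono_left nhdsWithin_le_nhds)

end IsLogBounded

/-! ### Special integrals of dilogarithm and trilogarithm type. -/

theorem im_intervalIntegral_eq {F : ℝ → ℂ} {g : ℝ → ℝ}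
    (hF : IntervalIntegrable F MeasureTheory.volume 0 1)
    (h : ∀ t ∈ Set.Ioo (0 : ℝ) 1, (F t).im = g t) :
    (∫ t in (0 : ℝ)..1, F t).im = ∫ t in (0 : ℝ)..1, g t := by
  have h1 := Complex.imCLM.intervalIntegral_comp_comm hF
  rw [Complex.imCLM_apply] at h1
  rw [← h1, intervalIntegral.integral_of_le zero_le_one, intervalIntegral.integral_of_le zero_le_one,
    MeasureTheory.integral_Ioc_eq_integral_Ioo, MeasureTheory.integral_Ioc_eq_integral_Ioo]
  exact MeasureTheory.setIntegral_congr_fun measurableSet_Ioo h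

theorem re_intervalIntegral_eq {F : ℝ → ℂ} {g : ℝ → ℝ}
    (hF : IntervalIntegrable F MeasureTheory.volume 0 1)
    (h : ∀ t ∈ Set.Ioo (0 : ℝ) 1, (F t).re = g t) :
    (∫ t in (0 : ℝ)..1, F t).re = ∫ t in (0 : ℝ)..1, g t := by
  have h1 := Complex.reCLM.intervalIntegral_comp_comm hF
  rw [Complex.reCLM_apply] at h1
  rw [← h1, intervalIntegral.integral_of_le zero_le_one, intervalIntegral.integral_of_le zero_le_one,
    MeasureTheory.integral_Ioc_eq_integral_Ioo, MeasureTheory.integral_Ioc_eq_integral_Ioo]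
  exact MeasureTheory.setIntegral_congr_fun measurableSet_Ioo h

theorem intervalIntegral_congr_Ioo {E : Type*} [NormedAddCommGroup E] [NormedSpace ℝ E]
    {f g : ℝ → E} (h : ∀ t ∈ Set.Ioo (0 : ℝ) 1, f t = g t) :
    ∫ t in (0 : ℝ)..1, f t = ∫ t in (0 : ℝ)..1, g t := by
  rw [intervalIntegral.integral_of_le zero_le_one, intervalIntegral.integral_of_le zero_le_one,
    MeasureTheory.integral_Ioc_eq_integral_Ioo, MeasureTheory.integral_Ioc_eq_integral_Ioo]
  exact MeasureTheory.setIntegral_congr_fun measurableSet_Ioo h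

theorem hasSum_integral_log_one_add_mul_div {z : ℂ} (hz : ‖z‖ ≤ 1) :
    HasSum (fun n : ℕ => (-1) ^ n * z ^ (n + 1) / ((n : ℂ) + 1) ^ 2)
      (∫ x in (0 : ℝ)..1, Complex.log (1 + z * x) / x) := by
  set f : ℕ → ℝ → ℂ := fun n x => (-1) ^ n * z ^ (n + 1) / ((n : ℂ) + 1) * (x : ℂ) ^ n with hf
  have hi : ∀ n, MeasureTheory.Integrable (f n)
      (MeasureTheory.volume.restrict (Set.Ioc (0 : ℝ) 1)) := fun n =>
    (intervalIntegrable_iff_integrableOn_Ioc_of_le zero_le_one).1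
      (Continuous.intervalIntegrable (by fun_prop) _ _)
  have hval : ∀ n, ∫ x in Set.Ioc (0 : ℝ) 1, f n x
      = (-1) ^ n * z ^ (n + 1) / ((n : ℂ) + 1) ^ 2 := by
    intro n
    have h : ∫ x in (0 : ℝ)..1, (x : ℂ) ^ n = 1 / ((n : ℂ) + 1) := by
      have := integral_pow (a := (0 : ℝ)) (b := 1) n
      have h2 : ∀ x : ℝ, (x : ℂ) ^ n = ((x ^ n : ℝ) : ℂ) := fun x => by push_cast; rfl
      simp only [h2]
      rw [intervalIntegral.integral_ofReal, this]
      simp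
    rw [← intervalIntegral.integral_of_le zero_le_one]
    simp only [hf]
    rw [intervalIntegral.integral_const_mul, h]
    rw [div_mul_div_comm, mul_one, sq]
  have hnorm : ∀ n, ∫ x in Set.Ioc (0 : ℝ) 1, ‖f n x‖ = ‖z‖ ^ (n + 1) / ((n : ℝ) + 1) ^ 2 := by
    intro n
    have : ∫ x in Set.Ioc (0 : ℝ) 1, ‖f n x‖
        = ∫ x in Set.Ioc (0 : ℝ) 1, ‖z‖ ^ (n + 1) / ((n : ℝ) + 1) * x ^ n := by
      refine MeasureTheory.setIntegral_congr_fun measurableSet_Ioc fun x hx => ?_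
      have h1 : ‖(n : ℂ) + 1‖ = (n : ℝ) + 1 := by
        rw [← Nat.cast_succ, Complex.norm_natCast, Nat.cast_succ]
      simp only [hf, norm_mul, norm_div, norm_pow, norm_neg, norm_one, one_pow, one_mul, h1,
        Complex.norm_real, Real.norm_of_nonneg hx.1.le]
    rw [this, MeasureTheory.integral_const_mul, ← intervalIntegral.integral_of_le zero_le_one,
      integral_pow]
    simp
    field_simp
  have hs : Summable fun n => ∫ x in Set.Ioc (0 : ℝ) 1, ‖f n x‖ := by
    simp only [hnorm]
    refine Summable.of_nonneg_of_le (fun n => by positivity) (fun n => ?_)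
      hasSum_inv_sq_succ.summable
    gcongr
    exact pow_le_one₀ (norm_nonneg _) hz
  have key := MeasureTheory.hasSum_integral_of_summable_integral_norm hi hs
  simp only [hval] at key
  convert! key using 1
  rw [intervalIntegral.integral_of_le zero_le_one,
    MeasureTheory.integral_Ioc_eq_integral_Ioo, MeasureTheory.integral_Ioc_eq_integral_Ioo]
  refine MeasureTheory.setIntegral_congr_fun measurableSet_Ioo fun x hx => ?_
  have hx0 : (x : ℂ) ≠ 0 := by exact_mod_cast hx.1.ne'
  have hlt : ‖z * (x : ℂ)‖ < 1 := by
    rw [norm_mul, Complex.norm_real, Real.norm_of_nonneg hx.1.le]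
    nlinarith [hx.1, hx.2, norm_nonneg z]
  have h := (hasSum_nat_add_iff' 1).2 (Complex.hasSum_taylorSeries_log hlt)
  have h2 := h.div_const (x : ℂ)
  have e : (fun n : ℕ => f n x)
      = fun n : ℕ => (-1) ^ (n + 1 + 1) * (z * (x : ℂ)) ^ (n + 1) / ((n + 1 : ℕ) : ℂ) / x := by
    funext n
    simp only [hf]
    have : (n : ℂ) + 1 ≠ 0 := Nat.cast_add_one_ne_zero n
    push_cast
    field_simp
    ring
  simp only [e, h2.tsum_eq]
  simp

theorem hasSum_catalanConstant :
    HasSum (fun k : ℕ => (-1 : ℝ) ^ k / (2 * (k : ℝ) + 1) ^ 2) catalanConstant := by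
  refine Summable.hasSum (Summable.of_norm_bounded hasSum_inv_sq_succ.summable fun k => ?_)
  rw [norm_div, norm_pow, norm_neg, norm_one, one_pow, Real.norm_of_nonneg (by positivity)]
  have : (0 : ℝ) ≤ k := by positivity
  gcongr
  linarith

theorem hasSum_alternating_inv_sq :
    HasSum (fun k : ℕ => (-1 : ℝ) ^ k / ((k : ℝ) + 1) ^ 2) (Real.pi ^ 2 / 12) := by
  have h := hasSum_inv_sq_succ
  have he : Summable fun k : ℕ => 1 / (((2 * k : ℕ) : ℝ) + 1) ^ 2 :=
    h.summable.comp_injective (i := fun k : ℕ => 2 * k) fun a b hab => by simpa using hab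
  have ho : HasSum (fun k : ℕ => 1 / (((2 * k + 1 : ℕ) : ℝ) + 1) ^ 2)
      (1 / 4 * (Real.pi ^ 2 / 6)) := by
    refine (h.mul_left (1 / 4)).congr_fun fun k => ?_
    push_cast
    field_simp
    ring
  have hsum := (HasSum.even_add_odd (f := fun k : ℕ => 1 / ((k : ℝ) + 1) ^ 2)
    he.hasSum ho).unique h
  have ho' : HasSum (fun k : ℕ => (-1 : ℝ) ^ (2 * k + 1) / (((2 * k + 1 : ℕ) : ℝ) + 1) ^ 2)
      (-(1 / 4 * (Real.pi ^ 2 / 6))) := by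
    refine ho.neg.congr_fun fun k => ?_
    rw [pow_succ, pow_mul]
    simp [neg_div]
  have he' : HasSum (fun k : ℕ => (-1 : ℝ) ^ (2 * k) / (((2 * k : ℕ) : ℝ) + 1) ^ 2) _ :=
    he.hasSum.congr_fun fun k => by rw [pow_mul]; simp
  have hval : (∑' k : ℕ, 1 / (((2 * k : ℕ) : ℝ) + 1) ^ 2) + -(1 / 4 * (Real.pi ^ 2 / 6))
      = Real.pi ^ 2 / 12 := by linarith
  rw [← hval]
  exact HasSum.even_add_odd (f := fun k : ℕ => (-1 : ℝ) ^ k / ((k : ℝ) + 1) ^ 2) he' ho'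

/-- In the power series, even indices are purely imaginary and give `G`; odd indices are real and
give a quarter of the alternating sum `π²/12`. -/
theorem integral_log_one_add_I_mul_div :
    ∫ x in (0 : ℝ)..1, Complex.log (1 + Complex.I * x) / x
      = ((Real.pi ^ 2 / 48 : ℝ) : ℂ) + (catalanConstant : ℂ) * Complex.I := by
  have h := hasSum_integral_log_one_add_mul_div (z := Complex.I) (by simp)
  have he := (Complex.hasSum_ofReal.2 hasSum_catalanConstant).mul_right Complex.I
  have ho := Complex.hasSum_ofReal.2 (hasSum_alternating_inv_sq.mul_left (1 / 4))
  have he' : HasSum (fun k : ℕ => (-1 : ℂ) ^ (2 * k) * Complex.I ^ (2 * k + 1)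
      / (((2 * k : ℕ) : ℂ) + 1) ^ 2) _ := he.congr_fun fun k => by
    rw [pow_succ Complex.I, pow_mul, pow_mul, Complex.I_sq]
    push_cast
    simp
    ring
  have ho' : HasSum (fun k : ℕ => (-1 : ℂ) ^ (2 * k + 1) * Complex.I ^ (2 * k + 1 + 1)
      / (((2 * k + 1 : ℕ) : ℂ) + 1) ^ 2) _ := ho.congr_fun fun k => by
    rw [show 2 * k + 1 + 1 = 2 * (k + 1) by ring, pow_succ (-1 : ℂ) (2 * k), pow_mul, pow_mul,
      Complex.I_sq, pow_succ]
    have : (k : ℂ) + 1 ≠ 0 := Nat.cast_add_one_ne_zero k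
    have h2 : (2 * (k : ℂ) + 1 + 1) ≠ 0 := by
      rw [show 2 * (k : ℂ) + 1 + 1 = 2 * ((k : ℂ) + 1) by ring]
      exact mul_ne_zero two_ne_zero this
    push_cast
    simp
    field_simp
    ring
  rw [h.unique (HasSum.even_add_odd (f := fun n : ℕ => (-1 : ℂ) ^ n * Complex.I ^ (n + 1)
    / ((n : ℂ) + 1) ^ 2) he' ho')]
  push_cast
  ring

/-- The substitution `t = 1 - x` reduces this to the dilogarithm series at `z = -1`, that is, to
`ζ(2)`. -/
theorem integral_log_div_sub_one :
    ∫ t in (0 : ℝ)..1, Real.log t / (t - 1) = Real.pi ^ 2 / 6 := by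
  have h := hasSum_integral_log_one_add_mul_div (z := -1) (by simp)
  have h1 := (Complex.hasSum_ofReal.2 hasSum_inv_sq_succ.neg)
  have h2 := h.unique (h1.congr_fun fun n => by
    rw [pow_succ (-1 : ℂ), ← mul_assoc, ← mul_pow]
    simp [neg_div])
  have h3 : ∫ x in (0 : ℝ)..1, Complex.log (1 + -1 * x) / x
      = ((∫ x in (0 : ℝ)..1, Real.log (1 - x) / x : ℝ) : ℂ) := by
    rw [← intervalIntegral.integral_ofReal]
    refine intervalIntegral_congr_Ioo fun x hx => ?_
    rw [Complex.ofReal_div, Complex.ofReal_log (by linarith [hx.2])]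
    push_cast
    ring_nf
  rw [h3] at h2
  have h4 := intervalIntegral.integral_comp_sub_left (a := 0) (b := 1)
    (fun t : ℝ => Real.log t / (t - 1)) 1
  norm_num at h4
  have h2' := Complex.ofReal_injective h2
  rw [← h4]
  have e : ∀ x : ℝ, Real.log (1 - x) / -x = -(Real.log (1 - x) / x) := fun x => div_neg _
  rw [intervalIntegral_congr_Ioo fun x _ => e x, intervalIntegral.integral_neg, h2', neg_neg]

theorem intervalIntegrable_trilog {z : ℂ} (hz : ∀ t ∈ Set.Icc (0 : ℝ) 1, 1 - z * (t : ℂ) ≠ 0) :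
    IntervalIntegrable (fun t : ℝ => z * ((Real.log t : ℝ) : ℂ) ^ 2 / (2 * (1 - z * (t : ℂ))))
      MeasureTheory.volume 0 1 := by
  have h1 : IntervalIntegrable (fun t : ℝ => ((Real.log t ^ 2 : ℝ) : ℂ))
      MeasureTheory.volume 0 1 :=
    ⟨intervalIntegrable_log_sq.1.ofReal, intervalIntegrable_log_sq.2.ofReal⟩
  have h2 : ContinuousOn (fun t : ℝ => z / (2 * (1 - z * (t : ℂ)))) (Set.uIcc 0 1) := by
    rw [Set.uIcc_of_le zero_le_one]
    exact ContinuousOn.div (by fun_prop) (by fun_prop) fun t ht => mul_ne_zero two_ne_zero (hz t ht)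
  refine (h1.mul_continuousOn h2).congr fun t _ => ?_
  push_cast
  ring

theorem im_trilog_one_add_I :
    (trilog (1 + Complex.I)).im
      = 1 / 2 * ∫ t in (0 : ℝ)..1, Real.log t ^ 2 / (2 * t ^ 2 - 2 * t + 1) := by
  have hq : ∀ t : ℝ, Complex.normSq (1 - (1 + Complex.I) * t) = 2 * t ^ 2 - 2 * t + 1 := fun t => by
    simp [Complex.normSq_apply]
    ring
  have hq0 : ∀ t : ℝ, 0 < 2 * t ^ 2 - 2 * t + 1 := fun t => by nlinarith [sq_nonneg (2 * t - 1)]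
  have hne : ∀ t : ℝ, 1 - (1 + Complex.I) * (t : ℂ) ≠ 0 := fun t h => by
    have := hq t
    rw [h, map_zero] at this
    linarith [hq0 t]
  rw [trilog, ← intervalIntegral.integral_const_mul]
  refine im_intervalIntegral_eq (intervalIntegrable_trilog fun t _ => hne t) fun t _ => ?_
  have e : (1 + Complex.I) * ((Real.log t : ℝ) : ℂ) ^ 2 / (2 * (1 - (1 + Complex.I) * (t : ℂ)))
      = ((Real.log t ^ 2 / 2 : ℝ) : ℂ) * ((1 + Complex.I) / (1 - (1 + Complex.I) * (t : ℂ))) := by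
    have := hne t
    push_cast
    field_simp
  rw [e, Complex.im_ofReal_mul, Complex.div_im, hq]
  have := hq0 t
  simp
  field_simp
  ring

/-- The integral is `2 Im Li₃(i)`, and `Im Li₃(i) = 1 - 1/3³ + 1/5³ - ⋯ = π³/32`. -/
theorem integral_log_sq_div_one_add_sq :
    ∫ t in (0 : ℝ)..1, Real.log t ^ 2 / (1 + t ^ 2) = Real.pi ^ 3 / 16 := by
  have hq : ∀ t : ℝ, Complex.normSq (1 - Complex.I * t) = 1 + t ^ 2 := fun t => by
    simp [Complex.normSq_apply]
    ring
  have hne : ∀ t : ℝ, 1 - Complex.I * (t : ℂ) ≠ 0 := fun t h => by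
    have := hq t
    rw [h, map_zero] at this
    nlinarith [sq_nonneg t]
  have h1 : (trilog Complex.I).im = 1 / 2 * ∫ t in (0 : ℝ)..1, Real.log t ^ 2 / (1 + t ^ 2) := by
    rw [trilog, ← intervalIntegral.integral_const_mul]
    refine im_intervalIntegral_eq (intervalIntegrable_trilog fun t _ => hne t) fun t _ => ?_
    have e : Complex.I * ((Real.log t : ℝ) : ℂ) ^ 2 / (2 * (1 - Complex.I * (t : ℂ)))
        = ((Real.log t ^ 2 / 2 : ℝ) : ℂ) * (Complex.I / (1 - Complex.I * (t : ℂ))) := by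
      have := hne t
      push_cast
      field_simp
    rw [e, Complex.im_ofReal_mul, Complex.div_im, hq]
    simp
    ring
  have h2 := Complex.hasSum_im (hasSum_trilog (z := Complex.I) (by simp))
  have h3 := (hasSum_nat_add_iff' 1).2 hasSum_L_function_mod_four_eval_three
  have e : ∀ n : ℕ, (Complex.I ^ (n + 1) / ((n : ℂ) + 1) ^ 3).im
      = 1 / ((n + 1 : ℕ) : ℝ) ^ 3 * Real.sin (Real.pi * ((n + 1 : ℕ) : ℝ) / 2) := fun n => by
    have h : Complex.I ^ (n + 1)
        = Complex.exp (((Real.pi * ((n + 1 : ℕ) : ℝ) / 2 : ℝ) : ℂ) * Complex.I) := by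
      conv_lhs => rw [← Complex.exp_pi_div_two_mul_I, ← Complex.exp_nat_mul]
      push_cast
      ring_nf
    have h' : ((n : ℂ) + 1) ^ 3 = (((n + 1 : ℕ) : ℝ) ^ 3 : ℝ) := by push_cast; rfl
    rw [h, h', Complex.div_ofReal_im, Complex.exp_ofReal_mul_I_im]
    ring
  simp only [e] at h2
  have h4 := h2.unique h3
  simp at h4
  linarith

/-! ### The logarithmic kernels, and explicit logarithms along the paths. -/

theorem re_ofReal_add_ofReal_mul_I (a b : ℝ) : ((a : ℂ) + (b : ℂ) * Complex.I).re = a := by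
  simp

theorem im_ofReal_add_ofReal_mul_I (a b : ℝ) : ((a : ℂ) + (b : ℂ) * Complex.I).im = b := by
  simp

theorem re_pos_of_mem_ball_two {z : ℂ} (hz : z ∈ Metric.ball (2 : ℂ) 2) : 0 < z.re := by
  rw [mem_ball_two_iff] at hz
  nlinarith [sq_nonneg z.re, sq_nonneg z.im]

theorem differentiableOn_log_ball_two :
    DifferentiableOn ℂ Complex.log (Metric.ball (2 : ℂ) 2) := fun _ hz =>
  (Complex.differentiableAt_log (Or.inl (re_pos_of_mem_ball_two hz))).differentiableWithinAt

/-- The function `log z / (z - 1)`, continued analytically to `z = 1`. -/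
noncomputable def logSlope : ℂ → ℂ := dslope Complex.log 1

theorem logSlope_eq {z : ℂ} (hz : z ≠ 1) : logSlope z = Complex.log z / (z - 1) := by
  rw [logSlope, dslope_of_ne _ hz, slope_def_field, Complex.log_one, sub_zero]

theorem norm_logSlope_le (z : ℂ) : ‖logSlope z‖ ≤ 2 * (1 + ‖Complex.log z‖) := by
  by_cases hz : z = 1
  · rw [hz, logSlope, dslope_same, (Complex.hasDerivAt_log (by simp)).deriv]
    simp
  · rw [logSlope_eq hz, norm_div]
    have hpos : 0 < ‖z - 1‖ := norm_pos_iff.2 (sub_ne_zero.2 hz)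
    rw [div_le_iff₀ hpos]
    -- Near `1` use `‖log z‖ ≤ (3/2)‖z - 1‖`; elsewhere the denominator is at least `1/2`.
    rcases le_total ‖z - 1‖ (1 / 2) with h | h
    · have h1 := Complex.norm_log_one_add_half_le_self h
      rw [add_sub_cancel] at h1
      nlinarith [mul_nonneg (norm_nonneg (Complex.log z)) hpos.le]
    · nlinarith [mul_nonneg (norm_nonneg (Complex.log z)) (sub_nonneg.2 h)]

theorem differentiableOn_logSlope : DifferentiableOn ℂ logSlope (Metric.ball (2 : ℂ) 2) := by
  rw [logSlope, Complex.differentiableOn_dslope]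
  · exact differentiableOn_log_ball_two
  · refine Metric.isOpen_ball.mem_nhds ?_
    rw [mem_ball_two_iff]
    norm_num

theorem isLogBounded_logSlope : IsLogBounded logSlope 2 where
  nonneg := by norm_num
  differentiableOn := differentiableOn_logSlope
  bound z _ := (norm_logSlope_le z).trans (by nlinarith [norm_nonneg (Complex.log z)])

theorem isLogBounded_log_mul_logSlope :
    IsLogBounded (fun z => Complex.log z * logSlope z) 2 where
  nonneg := by norm_num
  differentiableOn := differentiableOn_log_ball_two.mul differentiableOn_logSlope
  bound z _ := by
    rw [norm_mul]
    have h := mul_le_mul_of_nonneg_left (norm_logSlope_le z) (norm_nonneg (Complex.log z))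
    nlinarith [norm_nonneg (Complex.log z)]

theorem isLogBounded_log_sq_div_sub {p : ℂ} (hp : p = Complex.I ∨ p = -Complex.I) :
    IsLogBounded (fun z => Complex.log z ^ 2 / (z - p)) 3 where
  nonneg := by norm_num
  differentiableOn := (differentiableOn_log_ball_two.pow 2).div (by fun_prop) fun z hz h => by
    have h1 := re_pos_of_mem_ball_two hz
    rw [sub_eq_zero.1 h] at h1
    rcases hp with rfl | rfl <;> simp at h1
  bound z hz := by
    have h1 : |z.im| < 2 * z.re := hz.1
    rw [abs_lt] at h1
    -- The distance from `±i` to the sector is `1/√5 > 1/3`, with nearest boundary points `(2 ±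
    -- 4i)/5`; hence the squares supplied below.
    have h2 : (1 / 3 : ℝ) ≤ ‖z - p‖ := by
      rw [← sq_le_sq₀ (by norm_num) (norm_nonneg _), Complex.sq_norm, Complex.normSq_apply]
      rcases hp with rfl | rfl <;> simp <;>
        nlinarith [sq_nonneg (5 * z.im - 4), sq_nonneg (5 * z.im + 4)]
    rw [norm_div, norm_pow, div_le_iff₀ (by linarith)]
    have h3 := norm_nonneg (Complex.log z)
    nlinarith [mul_nonneg (sq_nonneg (1 + ‖Complex.log z‖)) (sub_nonneg.2 h2)]

theorem IsLogBounded.sub {φ ψ : ℂ → ℂ} {C D : ℝ} (hφ : IsLogBounded φ C)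
    (hψ : IsLogBounded ψ D) : IsLogBounded (fun z => φ z - ψ z) (C + D) where
  nonneg := add_nonneg hφ.nonneg hψ.nonneg
  differentiableOn := hφ.differentiableOn.sub hψ.differentiableOn
  bound z hz := (norm_sub_le _ _).trans (by linarith [hφ.bound z hz, hψ.bound z hz])

/-- The function `(log z)² (1 / (z - 1) - 1 / (z - p))`. -/
noncomputable def logSqKernel (p z : ℂ) : ℂ :=
  Complex.log z * logSlope z - Complex.log z ^ 2 / (z - p)

theorem isLogBounded_logSqKernel {p : ℂ} (hp : p = Complex.I ∨ p = -Complex.I) :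
    IsLogBounded (logSqKernel p) (2 + 3) :=
  isLogBounded_log_mul_logSlope.sub (isLogBounded_log_sq_div_sub hp)

theorem log_one_add_mul_I (x : ℝ) :
    Complex.log (1 + Complex.I * x)
      = ((Real.log (1 + x ^ 2) / 2 : ℝ) : ℂ) + (Real.arctan x : ℂ) * Complex.I := by
  have hn : ‖1 + Complex.I * (x : ℂ)‖ = √(1 + x ^ 2) := by
    rw [Complex.norm_def, Complex.normSq_apply]
    simp
    ring_nf
  apply Complex.ext
  · rw [Complex.log_re, hn, Real.log_sqrt (by positivity), re_ofReal_add_ofReal_mul_I]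
  · rw [Complex.log_im, Complex.arg_of_re_nonneg (by simp), hn, im_ofReal_add_ofReal_mul_I]
    simp [Real.arctan_eq_arcsin]

theorem one_add_I_mul_ne_zero (x : ℝ) : 1 + Complex.I * (x : ℂ) ≠ 0 := fun h => by
  have := congrArg Complex.re h
  simp at this

theorem log_ofReal_div_one_add_mul_I {y : ℝ} (hy : 0 < y) (x : ℝ) :
    Complex.log (y / (1 + Complex.I * x))
      = ((Real.log y - Real.log (1 + x ^ 2) / 2 : ℝ) : ℂ)
        + ((-Real.arctan x : ℝ) : ℂ) * Complex.I := by
  have harg : (1 + Complex.I * (x : ℂ)).arg ≠ Real.pi := by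
    rw [← Complex.log_im, log_one_add_mul_I, im_ofReal_add_ofReal_mul_I]
    have := Real.arctan_lt_pi_div_two x
    linarith [Real.pi_pos]
  rw [div_eq_mul_inv, Complex.log_ofReal_mul hy (inv_ne_zero (one_add_I_mul_ne_zero x)),
    Complex.log_inv _ harg, log_one_add_mul_I]
  push_cast
  ring

theorem log_one_add_I :
    Complex.log (1 + Complex.I)
      = ((Real.log 2 / 2 : ℝ) : ℂ) + ((Real.pi / 4 : ℝ) : ℂ) * Complex.I := by
  have e : 1 + Complex.I = 1 + Complex.I * ((1 : ℝ) : ℂ) := by simp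
  rw [e, log_one_add_mul_I, Real.arctan_one]
  norm_num

theorem log_one_sub_I :
    Complex.log (1 - Complex.I)
      = ((Real.log 2 / 2 : ℝ) : ℂ) + ((-(Real.pi / 4) : ℝ) : ℂ) * Complex.I := by
  have e : 1 - Complex.I = 1 + Complex.I * ((-1 : ℝ) : ℂ) := by simp [sub_eq_add_neg]
  rw [e, log_one_add_mul_I, Real.arctan_neg, Real.arctan_one]
  norm_num

theorem one_mem_logSector : (1 : ℂ) ∈ logSector := by
  refine ⟨?_, ?_⟩
  · change |(1 : ℂ).im| < 2 * (1 : ℂ).re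
    norm_num
  · rw [mem_ball_two_iff]
    norm_num

theorem one_add_I_mul_mem_logSector {x : ℝ} (hx : x ∈ Set.Icc (0 : ℝ) 1) :
    1 + Complex.I * (x : ℂ) ∈ logSector := by
  refine ⟨?_, ?_⟩
  · change |(1 + Complex.I * (x : ℂ)).im| < 2 * (1 + Complex.I * (x : ℂ)).re
    simp [abs_of_nonneg hx.1]
    linarith [hx.2]
  · rw [mem_ball_two_iff]
    simp
    nlinarith [hx.1, hx.2]

theorem ofReal_div_one_add_I_mul_mem_logSector {x y : ℝ} (hx : x ∈ Set.Icc (0 : ℝ) 1)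
    (hy : 0 < y) (hy2 : y ≤ 2) : (y : ℂ) / (1 + Complex.I * (x : ℂ)) ∈ logSector := by
  have hn : Complex.normSq (1 + Complex.I * (x : ℂ)) = 1 + x ^ 2 := by
    rw [Complex.normSq_apply]
    simp
    ring
  have hpos : 0 < 1 + x ^ 2 := by positivity
  have hre : ((y : ℂ) / (1 + Complex.I * (x : ℂ))).re = y / (1 + x ^ 2) := by
    rw [Complex.div_re, hn]
    simp
  have him : ((y : ℂ) / (1 + Complex.I * (x : ℂ))).im = -(y * x / (1 + x ^ 2)) := by
    rw [Complex.div_im, hn]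
    simp
  refine ⟨?_, ?_⟩
  · change |((y : ℂ) / (1 + Complex.I * (x : ℂ))).im| < 2 * ((y : ℂ) / (1 + Complex.I * (x : ℂ))).re
    rw [hre, him, abs_neg, abs_of_nonneg (div_nonneg (mul_nonneg hy.le hx.1) hpos.le),
      ← mul_div_assoc]
    exact div_lt_div_of_pos_right (by nlinarith [hx.2] : y * x < 2 * y) hpos
  · rw [mem_ball_two_iff, hre, him]
    have e : (y / (1 + x ^ 2)) ^ 2 + (-(y * x / (1 + x ^ 2))) ^ 2 = y * (y / (1 + x ^ 2)) := by
      field_simp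
    rw [e]
    have : 0 < y / (1 + x ^ 2) := by positivity
    nlinarith

theorem two_mul_sq_sub_pos (t : ℝ) : 0 < 2 * t ^ 2 - 2 * t + 1 := by
  nlinarith [sq_nonneg (2 * t - 1)]

theorem one_add_I_div_eq (t : ℝ) :
    (1 + Complex.I) / (t * (1 + Complex.I) - 1)
      = (((2 * t - 1) / (2 * t ^ 2 - 2 * t + 1) : ℝ) : ℂ)
        + ((-1 / (2 * t ^ 2 - 2 * t + 1) : ℝ) : ℂ) * Complex.I := by
  have hq := (two_mul_sq_sub_pos t).ne'
  have hn : Complex.normSq ((t : ℂ) * (1 + Complex.I) - 1) = 2 * t ^ 2 - 2 * t + 1 := by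
    simp [Complex.normSq_apply]
    ring
  apply Complex.ext
  · rw [Complex.div_re, hn, re_ofReal_add_ofReal_mul_I]
    simp
    ring
  · rw [Complex.div_im, hn, im_ofReal_add_ofReal_mul_I]
    simp
    ring

theorem one_sub_I_div_sub_div_eq (t : ℝ) :
    (1 - Complex.I) / (t * (1 - Complex.I) - 1) - (1 - Complex.I) / (t * (1 - Complex.I) + Complex.I)
      = ((2 / (2 * t ^ 2 - 2 * t + 1) : ℝ) : ℂ) * Complex.I := by
  have hq := (two_mul_sq_sub_pos t).ne'
  have hn : Complex.normSq ((t : ℂ) * (1 - Complex.I) - 1) = 2 * t ^ 2 - 2 * t + 1 := by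
    simp [Complex.normSq_apply]
    ring
  have hn' : Complex.normSq ((t : ℂ) * (1 - Complex.I) + Complex.I) = 2 * t ^ 2 - 2 * t + 1 := by
    simp [Complex.normSq_apply]
    ring
  apply Complex.ext
  · rw [Complex.sub_re, Complex.div_re, Complex.div_re, hn, hn', Complex.re_ofReal_mul]
    simp
    ring
  · rw [Complex.sub_im, Complex.div_im, Complex.div_im, hn, hn', Complex.im_ofReal_mul]
    simp
    ring

theorem mul_one_add_I_ne_one (t : ℝ) : (t : ℂ) * (1 + Complex.I) ≠ 1 := fun h => by
  have h1 := congrArg Complex.re h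
  have h2 := congrArg Complex.im h
  simp at h1 h2
  linarith

theorem mul_one_sub_I_ne_one (t : ℝ) : (t : ℂ) * (1 - Complex.I) ≠ 1 := fun h => by
  have h1 := congrArg Complex.re h
  have h2 := congrArg Complex.im h
  simp at h1 h2
  linarith

/-! ### Elementary integrals with denominator `2 t² - 2 t + 1` -/

theorem continuous_div_two_mul_sq_sub {g : ℝ → ℝ} (hg : Continuous g) :
    Continuous fun t : ℝ => g t / (2 * t ^ 2 - 2 * t + 1) :=
  hg.div (by fun_prop) fun t => (two_mul_sq_sub_pos t).ne'

theorem integral_one_div_two_mul_sq_sub :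
    ∫ t in (0 : ℝ)..1, 1 / (2 * t ^ 2 - 2 * t + 1) = Real.pi / 2 := by
  have hd : ∀ t ∈ Set.uIcc (0 : ℝ) 1, HasDerivAt (fun t : ℝ => Real.arctan (2 * t - 1))
      (1 / (2 * t ^ 2 - 2 * t + 1)) t := fun t _ => by
    refine ((((hasDerivAt_id t).const_mul 2).sub_const 1).arctan).congr_deriv ?_
    have h1 := (two_mul_sq_sub_pos t).ne'
    have h2 : 1 + (2 * t - 1) ^ 2 = 2 * (2 * t ^ 2 - 2 * t + 1) := by ring
    simp only [id, h2]
    field_simp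
  rw [intervalIntegral.integral_eq_sub_of_hasDerivAt hd
    ((continuous_div_two_mul_sq_sub continuous_const).intervalIntegrable _ _)]
  norm_num [Real.arctan_neg]
  ring

theorem integral_two_mul_sub_one_div_two_mul_sq_sub :
    ∫ t in (0 : ℝ)..1, (2 * t - 1) / (2 * t ^ 2 - 2 * t + 1) = 0 := by
  have hd : ∀ t ∈ Set.uIcc (0 : ℝ) 1, HasDerivAt
      (fun t : ℝ => Real.log (2 * t ^ 2 - 2 * t + 1) / 2)
      ((2 * t - 1) / (2 * t ^ 2 - 2 * t + 1)) t := fun t _ => by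
    have h1 := (two_mul_sq_sub_pos t).ne'
    have h := (((((hasDerivAt_pow 2 t).const_mul 2).sub
      ((hasDerivAt_id t).const_mul 2)).add_const 1).log h1).div_const 2
    refine h.congr_deriv ?_
    simp
    field_simp
  rw [intervalIntegral.integral_eq_sub_of_hasDerivAt hd
    ((continuous_div_two_mul_sq_sub (by fun_prop)).intervalIntegrable _ _)]
  norm_num

theorem intervalIntegrable_log_mul {g : ℝ → ℝ} (hg : Continuous g) :
    IntervalIntegrable (fun t => Real.log t * g t) MeasureTheory.volume 0 1 :=
  intervalIntegral.intervalIntegrable_log'.mul_continuousOn hg.continuousOn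

theorem intervalIntegrable_log_sq_mul {g : ℝ → ℝ} (hg : Continuous g) :
    IntervalIntegrable (fun t => Real.log t ^ 2 * g t) MeasureTheory.volume 0 1 :=
  intervalIntegrable_log_sq.mul_continuousOn hg.continuousOn

theorem integral_polynomial_log_mul (a b c : ℝ) {g : ℝ → ℝ} (hg : Continuous g) :
    ∫ t in (0 : ℝ)..1, (a * Real.log t ^ 2 + b * Real.log t + c) * g t
      = a * (∫ t in (0 : ℝ)..1, Real.log t ^ 2 * g t)
        + b * (∫ t in (0 : ℝ)..1, Real.log t * g t) + c * ∫ t in (0 : ℝ)..1, g t := by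
  have i2 := (intervalIntegrable_log_sq_mul hg).const_mul a
  have i1 := (intervalIntegrable_log_mul hg).const_mul b
  have i0 := (hg.intervalIntegrable (μ := MeasureTheory.volume) 0 1).const_mul c
  rw [← intervalIntegral.integral_const_mul, ← intervalIntegral.integral_const_mul,
    ← intervalIntegral.integral_const_mul, ← intervalIntegral.integral_add i2 i1,
    ← intervalIntegral.integral_add (i2.add i1) i0]
  refine intervalIntegral_congr_Ioo fun t _ => ?_
  ring

theorem intervalIntegrable_polynomial_log_mul (a b c : ℝ) {g : ℝ → ℝ} (hg : Continuous g) :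
    IntervalIntegrable (fun t => (a * Real.log t ^ 2 + b * Real.log t + c) * g t)
      MeasureTheory.volume 0 1 := by
  have i2 := (intervalIntegrable_log_sq_mul hg).const_mul a
  have i1 := (intervalIntegrable_log_mul hg).const_mul b
  have i0 := (hg.intervalIntegrable (μ := MeasureTheory.volume) 0 1).const_mul c
  refine ((i2.add i1).add i0).congr fun t _ => ?_
  ring

/-! ### Integrals along segments from the origin -/

theorem ofReal_ne_one_of_mem_Ioo {t : ℝ} (ht : t ∈ Set.Ioo (0 : ℝ) 1) : (t : ℂ) ≠ 1 := by
  exact_mod_cast ht.2.ne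

theorem logSlope_ofReal {t : ℝ} (ht : t ∈ Set.Ioo (0 : ℝ) 1) :
    logSlope t = ((Real.log t / (t - 1) : ℝ) : ℂ) := by
  rw [logSlope_eq (ofReal_ne_one_of_mem_Ioo ht), ← Complex.ofReal_log ht.1.le]
  push_cast
  rfl

theorem rayIntegral_logSlope_one : rayIntegral logSlope 1 = ((Real.pi ^ 2 / 6 : ℝ) : ℂ) := by
  rw [← integral_log_div_sub_one, ← intervalIntegral.integral_ofReal, rayIntegral]
  refine intervalIntegral_congr_Ioo fun t ht => ?_
  rw [one_mul, mul_one, logSlope_ofReal ht]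

theorem im_rayIntegral_log_mul_logSlope_one :
    (rayIntegral (fun z => Complex.log z * logSlope z) 1).im = 0 := by
  rw [rayIntegral, im_intervalIntegral_eq (g := fun _ => 0)
    (isLogBounded_log_mul_logSlope.intervalIntegrable_ray one_mem_logSector) fun t ht => ?_]
  · simp
  · rw [one_mul, mul_one, logSlope_ofReal ht, ← Complex.ofReal_log ht.1.le, ← Complex.ofReal_mul,
      Complex.ofReal_im]

theorem im_ofReal_sub_div (a b c : ℝ) (p : ℂ) :
    ((a : ℂ) * (b : ℂ) - (c : ℂ) ^ 2 / p).im = -(c ^ 2 * (p⁻¹).im) := by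
  rw [← Complex.ofReal_mul, ← Complex.ofReal_pow, div_eq_mul_inv, Complex.sub_im,
    Complex.ofReal_im, Complex.im_ofReal_mul, zero_sub]

theorem im_rayIntegral_logSqKernel_neg_I_one :
    (rayIntegral (logSqKernel (-Complex.I)) 1).im = Real.pi ^ 3 / 16 := by
  rw [rayIntegral, im_intervalIntegral_eq (g := fun t => Real.log t ^ 2 / (1 + t ^ 2))
    ((isLogBounded_logSqKernel (Or.inr rfl)).intervalIntegrable_ray one_mem_logSector)
    fun t ht => ?_, integral_log_sq_div_one_add_sq]
  rw [one_mul, mul_one, logSqKernel, logSlope_ofReal ht, ← Complex.ofReal_log ht.1.le,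
    im_ofReal_sub_div, Complex.inv_im, Complex.normSq_apply]
  simp
  ring

theorem im_rayIntegral_logSqKernel_I_one :
    (rayIntegral (logSqKernel Complex.I) 1).im = -(Real.pi ^ 3 / 16) := by
  rw [rayIntegral, im_intervalIntegral_eq (g := fun t => -(Real.log t ^ 2 / (1 + t ^ 2)))
    ((isLogBounded_logSqKernel (Or.inl rfl)).intervalIntegrable_ray one_mem_logSector)
    fun t ht => ?_, intervalIntegral.integral_neg, integral_log_sq_div_one_add_sq]
  rw [one_mul, mul_one, logSqKernel, logSlope_ofReal ht, ← Complex.ofReal_log ht.1.le,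
    im_ofReal_sub_div, Complex.inv_im, Complex.normSq_apply]
  simp
  ring

theorem one_add_I_mem_logSector : 1 + Complex.I ∈ logSector := by
  simpa using one_add_I_mul_mem_logSector (x := 1) (by simp)

theorem one_sub_I_eq : ((2 : ℝ) : ℂ) / (1 + Complex.I * ((1 : ℝ) : ℂ)) = 1 - Complex.I := by
  rw [div_eq_iff (one_add_I_mul_ne_zero 1)]
  push_cast
  linear_combination Complex.I_sq

theorem one_sub_I_mem_logSector : 1 - Complex.I ∈ logSector := by
  rw [← one_sub_I_eq]
  exact ofReal_div_one_add_I_mul_mem_logSector (by simp) two_pos le_rfl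

theorem log_ofReal_mul_one_add_I {t : ℝ} (ht : 0 < t) :
    Complex.log (t * (1 + Complex.I))
      = ((Real.log t + Real.log 2 / 2 : ℝ) : ℂ) + ((Real.pi / 4 : ℝ) : ℂ) * Complex.I := by
  rw [Complex.log_ofReal_mul ht (ne_zero_of_mem_logSector one_add_I_mem_logSector), log_one_add_I]
  push_cast
  ring

theorem log_ofReal_mul_one_sub_I {t : ℝ} (ht : 0 < t) :
    Complex.log (t * (1 - Complex.I))
      = ((Real.log t + Real.log 2 / 2 : ℝ) : ℂ) + ((-(Real.pi / 4) : ℝ) : ℂ) * Complex.I := by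
  rw [Complex.log_ofReal_mul ht (ne_zero_of_mem_logSector one_sub_I_mem_logSector), log_one_sub_I]
  push_cast
  ring

theorem one_add_I_mul_logSlope {t : ℝ} :
    (1 + Complex.I) * logSlope (t * (1 + Complex.I))
      = Complex.log (t * (1 + Complex.I))
        * ((((2 * t - 1) / (2 * t ^ 2 - 2 * t + 1) : ℝ) : ℂ)
          + ((-1 / (2 * t ^ 2 - 2 * t + 1) : ℝ) : ℂ) * Complex.I) := by
  rw [logSlope_eq (mul_one_add_I_ne_one t), ← one_add_I_div_eq]
  ring

theorem re_ofReal_mul_ofReal (a b c d : ℝ) :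
    (((a : ℂ) + (b : ℂ) * Complex.I) * ((c : ℂ) + (d : ℂ) * Complex.I)).re = a * c - b * d := by
  simp

theorem im_ofReal_mul_ofReal (a b c d : ℝ) :
    (((a : ℂ) + (b : ℂ) * Complex.I) * ((c : ℂ) + (d : ℂ) * Complex.I)).im = a * d + b * c := by
  simp

theorem re_rayIntegral_logSlope_one_add_I :
    (rayIntegral logSlope (1 + Complex.I)).re
      = (∫ t in (0 : ℝ)..1, Real.log t * ((2 * t - 1) / (2 * t ^ 2 - 2 * t + 1)))
        + Real.pi ^ 2 / 8 := by
  have g0 := continuous_div_two_mul_sq_sub (g := fun _ => 1) continuous_const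
  have g1 := continuous_div_two_mul_sq_sub (g := fun t => 2 * t - 1) (by fun_prop)
  rw [rayIntegral, re_intervalIntegral_eq (g := fun t =>
    (0 * Real.log t ^ 2 + 1 * Real.log t + Real.log 2 / 2)
        * ((2 * t - 1) / (2 * t ^ 2 - 2 * t + 1))
      + (0 * Real.log t ^ 2 + 0 * Real.log t + Real.pi / 4) * (1 / (2 * t ^ 2 - 2 * t + 1)))
    (isLogBounded_logSlope.intervalIntegrable_ray one_add_I_mem_logSector) fun t ht => ?_]
  · rw [intervalIntegral.integral_add (intervalIntegrable_polynomial_log_mul _ _ _ g1)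
      (intervalIntegrable_polynomial_log_mul _ _ _ g0), integral_polynomial_log_mul _ _ _ g1,
      integral_polynomial_log_mul _ _ _ g0, integral_one_div_two_mul_sq_sub,
      integral_two_mul_sub_one_div_two_mul_sq_sub]
    ring
  · rw [one_add_I_mul_logSlope, log_ofReal_mul_one_add_I ht.1, re_ofReal_mul_ofReal]
    ring

theorem im_rayIntegral_logSlope_one_add_I :
    (rayIntegral logSlope (1 + Complex.I)).im
      = -(∫ t in (0 : ℝ)..1, Real.log t * (1 / (2 * t ^ 2 - 2 * t + 1)))
        - Real.log 2 * Real.pi / 4 := by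
  have g0 := continuous_div_two_mul_sq_sub (g := fun _ => 1) continuous_const
  have g1 := continuous_div_two_mul_sq_sub (g := fun t => 2 * t - 1) (by fun_prop)
  rw [rayIntegral, im_intervalIntegral_eq (g := fun t =>
    (0 * Real.log t ^ 2 + (-1) * Real.log t + (-(Real.log 2 / 2)))
        * (1 / (2 * t ^ 2 - 2 * t + 1))
      + (0 * Real.log t ^ 2 + 0 * Real.log t + Real.pi / 4)
        * ((2 * t - 1) / (2 * t ^ 2 - 2 * t + 1)))
    (isLogBounded_logSlope.intervalIntegrable_ray one_add_I_mem_logSector) fun t ht => ?_]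
  · rw [intervalIntegral.integral_add (intervalIntegrable_polynomial_log_mul _ _ _ g0)
      (intervalIntegrable_polynomial_log_mul _ _ _ g1), integral_polynomial_log_mul _ _ _ g1,
      integral_polynomial_log_mul _ _ _ g0, integral_one_div_two_mul_sq_sub,
      integral_two_mul_sub_one_div_two_mul_sq_sub]
    ring
  · rw [one_add_I_mul_logSlope, log_ofReal_mul_one_add_I ht.1, im_ofReal_mul_ofReal]
    ring

theorem integral_log_sq_mul_eq :
    ∫ t in (0 : ℝ)..1, Real.log t ^ 2 * (1 / (2 * t ^ 2 - 2 * t + 1))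
      = 2 * (trilog (1 + Complex.I)).im := by
  rw [im_trilog_one_add_I]
  simp only [mul_one_div]
  ring

theorem im_rayIntegral_log_mul_logSlope_one_add_I :
    (rayIntegral (fun z => Complex.log z * logSlope z) (1 + Complex.I)).im
      = -(2 * (trilog (1 + Complex.I)).im
          + Real.log 2 * (∫ t in (0 : ℝ)..1, Real.log t * (1 / (2 * t ^ 2 - 2 * t + 1)))
          + (Real.log 2 ^ 2 / 4 - Real.pi ^ 2 / 16) * (Real.pi / 2))
        + Real.pi / 2
          * ∫ t in (0 : ℝ)..1, Real.log t * ((2 * t - 1) / (2 * t ^ 2 - 2 * t + 1)) := by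
  have g0 := continuous_div_two_mul_sq_sub (g := fun _ => 1) continuous_const
  have g1 := continuous_div_two_mul_sq_sub (g := fun t => 2 * t - 1) (by fun_prop)
  rw [rayIntegral, im_intervalIntegral_eq (g := fun t =>
    ((-1) * Real.log t ^ 2 + (-Real.log 2) * Real.log t
        + (-(Real.log 2 ^ 2 / 4 - Real.pi ^ 2 / 16))) * (1 / (2 * t ^ 2 - 2 * t + 1))
      + (0 * Real.log t ^ 2 + Real.pi / 2 * Real.log t + Real.pi * Real.log 2 / 4)
        * ((2 * t - 1) / (2 * t ^ 2 - 2 * t + 1)))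
    (isLogBounded_log_mul_logSlope.intervalIntegrable_ray one_add_I_mem_logSector)
    fun t ht => ?_]
  · rw [intervalIntegral.integral_add (intervalIntegrable_polynomial_log_mul _ _ _ g0)
      (intervalIntegrable_polynomial_log_mul _ _ _ g1), integral_polynomial_log_mul _ _ _ g1,
      integral_polynomial_log_mul _ _ _ g0, integral_one_div_two_mul_sq_sub,
      integral_two_mul_sub_one_div_two_mul_sq_sub, integral_log_sq_mul_eq]
    ring
  · rw [mul_left_comm, one_add_I_mul_logSlope, log_ofReal_mul_one_add_I ht.1, Complex.mul_im,
      re_ofReal_mul_ofReal, im_ofReal_mul_ofReal, re_ofReal_add_ofReal_mul_I,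
      im_ofReal_add_ofReal_mul_I]
    ring

/-- On this ray the rational factor is the purely imaginary `2i/(2t²-2t+1)`, so only `Re log² = (log
t + ½ log 2)² - π²/16` matters. -/
theorem im_rayIntegral_logSqKernel_one_sub_I :
    (rayIntegral (logSqKernel (-Complex.I)) (1 - Complex.I)).im
      = 2 * (2 * (trilog (1 + Complex.I)).im
          + Real.log 2 * (∫ t in (0 : ℝ)..1, Real.log t * (1 / (2 * t ^ 2 - 2 * t + 1)))
          + (Real.log 2 ^ 2 / 4 - Real.pi ^ 2 / 16) * (Real.pi / 2)) := by
  have g0 := continuous_div_two_mul_sq_sub (g := fun _ => 1) continuous_const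
  rw [rayIntegral, im_intervalIntegral_eq (g := fun t =>
    (2 * Real.log t ^ 2 + (2 * Real.log 2) * Real.log t
        + 2 * (Real.log 2 ^ 2 / 4 - Real.pi ^ 2 / 16)) * (1 / (2 * t ^ 2 - 2 * t + 1)))
    ((isLogBounded_logSqKernel (Or.inr rfl)).intervalIntegrable_ray one_sub_I_mem_logSector)
    fun t ht => ?_]
  · rw [integral_polynomial_log_mul _ _ _ g0, integral_one_div_two_mul_sq_sub,
      integral_log_sq_mul_eq]
    ring
  · have e : (1 - Complex.I) * logSqKernel (-Complex.I) (t * (1 - Complex.I))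
        = Complex.log (t * (1 - Complex.I)) * Complex.log (t * (1 - Complex.I))
          * (((0 : ℝ) : ℂ) + ((2 / (2 * t ^ 2 - 2 * t + 1) : ℝ) : ℂ) * Complex.I) := by
      rw [Complex.ofReal_zero, zero_add, ← one_sub_I_div_sub_div_eq, logSqKernel,
        logSlope_eq (mul_one_sub_I_ne_one t), sub_neg_eq_add]
      ring
    rw [e, log_ofReal_mul_one_sub_I ht.1, Complex.mul_im,
      re_ofReal_mul_ofReal, im_ofReal_mul_ofReal, re_ofReal_add_ofReal_mul_I,
      im_ofReal_add_ofReal_mul_I]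
    ring

/-! ### Integrals along paths -/

theorem hasDerivAt_one_add_I_mul (x : ℝ) :
    HasDerivAt (fun x : ℝ => 1 + Complex.I * (x : ℂ)) Complex.I x := by
  simpa using ((Complex.ofRealCLM.hasDerivAt (x := x)).const_mul Complex.I).const_add 1

theorem logSlope_one_add_I_mul {x : ℝ} (hx : x ≠ 0) :
    logSlope (1 + Complex.I * x) * Complex.I = Complex.log (1 + Complex.I * x) / x := by
  have hx' : (x : ℂ) ≠ 0 := by exact_mod_cast hx
  have h1 : 1 + Complex.I * (x : ℂ) ≠ 1 := by simpa using hx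
  rw [logSlope_eq h1]
  have := Complex.I_ne_zero
  field_simp
  ring

/-- The left side is `∫ log(1+ix)/x dx`, seen as the integral of `logSlope` from `1` to `1+i`. Its
real and imaginary parts determine the two integrals with a single `log t` over `2t²-2t+1`. -/
theorem rayIntegral_logSlope_sub :
    ((Real.pi ^ 2 / 48 : ℝ) : ℂ) + (catalanConstant : ℂ) * Complex.I
      = rayIntegral logSlope (1 + Complex.I) - ((Real.pi ^ 2 / 6 : ℝ) : ℂ) := by
  have h := isLogBounded_logSlope.integral_path_of_contDiff
    (fun x _ => hasDerivAt_one_add_I_mul x) continuousOn_const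
    (fun x hx => one_add_I_mul_mem_logSector hx)
  rw [intervalIntegral_congr_Ioo fun x hx => logSlope_one_add_I_mul hx.1.ne',
    integral_log_one_add_I_mul_div] at h
  simpa [rayIntegral_logSlope_one] using h

theorem integral_log_mul_two_mul_sub_one_div :
    ∫ t in (0 : ℝ)..1, Real.log t * ((2 * t - 1) / (2 * t ^ 2 - 2 * t + 1))
      = Real.pi ^ 2 / 16 := by
  have h := congrArg Complex.re rayIntegral_logSlope_sub
  rw [re_ofReal_add_ofReal_mul_I, Complex.sub_re, re_rayIntegral_logSlope_one_add_I,
    Complex.ofReal_re] at h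
  linarith

theorem integral_log_mul_one_div :
    ∫ t in (0 : ℝ)..1, Real.log t * (1 / (2 * t ^ 2 - 2 * t + 1))
      = -catalanConstant - Real.log 2 * Real.pi / 4 := by
  have h := congrArg Complex.im rayIntegral_logSlope_sub
  rw [im_ofReal_add_ofReal_mul_I, Complex.sub_im, im_rayIntegral_logSlope_one_add_I,
    Complex.ofReal_im] at h
  linarith

theorem im_integral_log_sq_one_add_I_mul_div :
    IntervalIntegrable (fun x : ℝ => Complex.log (1 + Complex.I * x) ^ 2 / x)
        MeasureTheory.volume 0 1 ∧
      (∫ x in (0 : ℝ)..1, Complex.log (1 + Complex.I * x) ^ 2 / x).im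
        = -2 * (trilog (1 + Complex.I)).im + catalanConstant * Real.log 2
          + Real.pi / 8 * Real.log 2 ^ 2 + Real.pi ^ 3 / 16 := by
  have e : ∀ x ∈ Set.Ioo (0 : ℝ) 1, Complex.log (1 + Complex.I * x)
      * logSlope (1 + Complex.I * x) * Complex.I = Complex.log (1 + Complex.I * x) ^ 2 / x := by
    intro x hx
    rw [mul_assoc, logSlope_one_add_I_mul hx.1.ne']
    ring
  have h := isLogBounded_log_mul_logSlope.integral_path_of_contDiff
    (fun x _ => hasDerivAt_one_add_I_mul x) continuousOn_const
    (fun x hx => one_add_I_mul_mem_logSector hx)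
  have hi := isLogBounded_log_mul_logSlope.intervalIntegrable_path
    (fun x _ => hasDerivAt_one_add_I_mul x) continuousOn_const
    (fun x hx => one_add_I_mul_mem_logSector hx)
  refine ⟨hi.congr_uIoo (by rw [Set.uIoo_of_le zero_le_one]; exact e), ?_⟩
  rw [intervalIntegral_congr_Ioo e] at h
  rw [h]
  simp only [Complex.ofReal_one, mul_one, Complex.ofReal_zero, mul_zero, add_zero]
  rw [Complex.sub_im, im_rayIntegral_log_mul_logSlope_one,
    im_rayIntegral_log_mul_logSlope_one_add_I, integral_log_mul_two_mul_sub_one_div,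
    integral_log_mul_one_div]
  ring

theorem continuous_one_add_I_mul_inv_sq (c : ℂ) :
    Continuous fun x : ℝ => c / (1 + Complex.I * (x : ℂ)) ^ 2 :=
  continuous_const.div (by fun_prop) fun x => pow_ne_zero 2 (one_add_I_mul_ne_zero x)

theorem hasDerivAt_one_add_div (x : ℝ) :
    HasDerivAt (fun x : ℝ => ((1 + x : ℝ) : ℂ) / (1 + Complex.I * (x : ℂ)))
      ((1 - Complex.I) / (1 + Complex.I * (x : ℂ)) ^ 2) x := by
  have h1 : HasDerivAt (fun x : ℝ => ((1 + x : ℝ) : ℂ)) 1 x := by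
    simpa using ((hasDerivAt_id x).const_add 1).ofReal_comp
  refine (h1.div (hasDerivAt_one_add_I_mul x) (one_add_I_mul_ne_zero x)).congr_deriv ?_
  push_cast
  ring

theorem hasDerivAt_one_sub_div (x : ℝ) :
    HasDerivAt (fun x : ℝ => ((1 - x : ℝ) : ℂ) / (1 + Complex.I * (x : ℂ)))
      (-(1 + Complex.I) / (1 + Complex.I * (x : ℂ)) ^ 2) x := by
  have h1 : HasDerivAt (fun x : ℝ => ((1 - x : ℝ) : ℂ)) (-1) x := by
    simpa using ((hasDerivAt_id x).const_sub 1).ofReal_comp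
  refine (h1.div (hasDerivAt_one_add_I_mul x) (one_add_I_mul_ne_zero x)).congr_deriv ?_
  push_cast
  ring

theorem one_sub_I_ne_zero : 1 - Complex.I ≠ 0 := ne_zero_of_mem_logSector one_sub_I_mem_logSector

theorem one_add_I_ne_zero : 1 + Complex.I ≠ 0 := ne_zero_of_mem_logSector one_add_I_mem_logSector

/-- The Möbius map `u = (1+x)/(1+ix)` sends `0` to `1` and `∞` to `-i`, so `x` is a constant
multiple of `(u-1)/(u+i)` and `dx/x = du/(u-1) - du/(u+i)`. -/
theorem logSqKernel_one_add_div {x : ℝ} (hx : x ≠ 0) :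
    logSqKernel (-Complex.I) (((1 + x : ℝ) : ℂ) / (1 + Complex.I * x))
        * ((1 - Complex.I) / (1 + Complex.I * x) ^ 2)
      = Complex.log (((1 + x : ℝ) : ℂ) / (1 + Complex.I * x)) ^ 2 / x := by
  have hx' : (x : ℂ) ≠ 0 := by exact_mod_cast hx
  have hne := one_add_I_mul_ne_zero x
  have hm := one_sub_I_ne_zero
  have hp := one_add_I_ne_zero
  have e1 : ((1 + x : ℝ) : ℂ) / (1 + Complex.I * x) - 1
      = x * (1 - Complex.I) / (1 + Complex.I * x) := by
    rw [div_sub_one hne]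
    push_cast
    ring
  have e2 : ((1 + x : ℝ) : ℂ) / (1 + Complex.I * x) + Complex.I
      = (1 + Complex.I) / (1 + Complex.I * x) := by
    rw [div_add' _ _ _ hne]
    congr 1
    push_cast
    linear_combination (x : ℂ) * Complex.I_sq
  have h1 : ((1 + x : ℝ) : ℂ) / (1 + Complex.I * x) ≠ 1 := by
    rw [← sub_ne_zero, e1]
    exact div_ne_zero (mul_ne_zero hx' hm) hne
  rw [logSqKernel, logSlope_eq h1, sub_neg_eq_add, e1, e2]
  generalize Complex.log (((1 + x : ℝ) : ℂ) / (1 + Complex.I * x)) = w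
  have hD : (1 + Complex.I) * (1 + Complex.I * x) = (1 + Complex.I) - x * (1 - Complex.I) := by
    linear_combination (x : ℂ) * Complex.I_sq
  generalize 1 + Complex.I * (x : ℂ) = D at *
  field_simp
  linear_combination (-w ^ 2) * hD

/-- Here `u = (1-x)/(1+ix)` sends `∞` to `i`, so the second pole is at `i`. -/
theorem logSqKernel_one_sub_div {x : ℝ} (hx : x ≠ 0) :
    logSqKernel Complex.I (((1 - x : ℝ) : ℂ) / (1 + Complex.I * x))
        * (-(1 + Complex.I) / (1 + Complex.I * x) ^ 2)
      = Complex.log (((1 - x : ℝ) : ℂ) / (1 + Complex.I * x)) ^ 2 / x := by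
  have hx' : (x : ℂ) ≠ 0 := by exact_mod_cast hx
  have hne := one_add_I_mul_ne_zero x
  have hm := one_sub_I_ne_zero
  have hp := one_add_I_ne_zero
  have e1 : ((1 - x : ℝ) : ℂ) / (1 + Complex.I * x) - 1
      = -(x * (1 + Complex.I)) / (1 + Complex.I * x) := by
    rw [div_sub_one hne]
    push_cast
    ring
  have e2 : ((1 - x : ℝ) : ℂ) / (1 + Complex.I * x) - Complex.I
      = (1 - Complex.I) / (1 + Complex.I * x) := by
    rw [div_sub' hne]
    congr 1
    push_cast
    linear_combination (-(x : ℂ)) * Complex.I_sq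
  have h1 : ((1 - x : ℝ) : ℂ) / (1 + Complex.I * x) ≠ 1 := by
    rw [← sub_ne_zero, e1]
    exact div_ne_zero (neg_ne_zero.2 (mul_ne_zero hx' hp)) hne
  rw [logSqKernel, logSlope_eq h1, e1, e2]
  generalize Complex.log (((1 - x : ℝ) : ℂ) / (1 + Complex.I * x)) = w
  have hD : (1 - Complex.I) * (1 + Complex.I * x) = (1 - Complex.I) + x * (1 + Complex.I) := by
    linear_combination (-(x : ℂ)) * Complex.I_sq
  generalize 1 + Complex.I * (x : ℂ) = D at *
  field_simp
  linear_combination (-w ^ 2) * hD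

theorem im_integral_log_sq_one_add_div :
    IntervalIntegrable
        (fun x : ℝ => Complex.log (((1 + x : ℝ) : ℂ) / (1 + Complex.I * x)) ^ 2 / x)
        MeasureTheory.volume 0 1 ∧
      (∫ x in (0 : ℝ)..1,
          Complex.log (((1 + x : ℝ) : ℂ) / (1 + Complex.I * x)) ^ 2 / x).im
        = 4 * (trilog (1 + Complex.I)).im - 2 * catalanConstant * Real.log 2
          - Real.pi / 4 * Real.log 2 ^ 2 - Real.pi ^ 3 / 8 := by
  have hb := isLogBounded_logSqKernel (p := -Complex.I) (Or.inr rfl)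
  have hmem : ∀ x ∈ Set.Icc (0 : ℝ) 1,
      ((1 + x : ℝ) : ℂ) / (1 + Complex.I * (x : ℂ)) ∈ logSector := fun x hx =>
    ofReal_div_one_add_I_mul_mem_logSector hx (by linarith [hx.1]) (by linarith [hx.2])
  have hc := (continuous_one_add_I_mul_inv_sq (1 - Complex.I)).continuousOn (s := Set.Icc 0 1)
  have h := hb.integral_path_of_contDiff (fun x _ => hasDerivAt_one_add_div x) hc hmem
  have hi := hb.intervalIntegrable_path (fun x _ => hasDerivAt_one_add_div x) hc hmem
  have e : ∀ x ∈ Set.Ioo (0 : ℝ) 1, _ = _ := fun x hx => logSqKernel_one_add_div hx.1.ne'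
  refine ⟨hi.congr_uIoo (by rw [Set.uIoo_of_le zero_le_one]; exact e), ?_⟩
  rw [intervalIntegral_congr_Ioo e] at h
  rw [h, one_add_one_eq_two, one_sub_I_eq]
  simp only [add_zero, Complex.ofReal_one, Complex.ofReal_zero, mul_zero, div_one]
  rw [Complex.sub_im, im_rayIntegral_logSqKernel_neg_I_one, im_rayIntegral_logSqKernel_one_sub_I,
    integral_log_mul_one_div]
  ring

/-- The path runs from `1` into the singular point `0`, where the ray integral tends to `0`; only
the ray to `1` contributes. -/
theorem im_integral_log_sq_one_sub_div :
    IntervalIntegrable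
        (fun x : ℝ => Complex.log (((1 - x : ℝ) : ℂ) / (1 + Complex.I * x)) ^ 2 / x)
        MeasureTheory.volume 0 1 ∧
      (∫ x in (0 : ℝ)..1,
          Complex.log (((1 - x : ℝ) : ℂ) / (1 + Complex.I * x)) ^ 2 / x).im
        = Real.pi ^ 3 / 16 := by
  have hb := isLogBounded_logSqKernel (p := Complex.I) (Or.inl rfl)
  have hmem : ∀ x ∈ Set.Ico (0 : ℝ) 1,
      ((1 - x : ℝ) : ℂ) / (1 + Complex.I * (x : ℂ)) ∈ logSector := fun x hx =>
    ofReal_div_one_add_I_mul_mem_logSector (Set.Ico_subset_Icc_self hx) (by linarith [hx.2])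
      (by linarith [hx.1])
  have hinv : ∀ x ∈ Set.Icc (0 : ℝ) 1, ((1 : ℝ) : ℂ) / (1 + Complex.I * (x : ℂ)) ∈ logSector :=
    fun x hx => ofReal_div_one_add_I_mul_mem_logSector hx one_pos one_le_two
  have e : ∀ x ∈ Set.Ioo (0 : ℝ) 1, _ = _ := fun x hx => logSqKernel_one_sub_div hx.1.ne'
  have hcont : Continuous fun x : ℝ => ((1 - x : ℝ) : ℂ) / (1 + Complex.I * (x : ℂ)) :=
    Continuous.div (by fun_prop) (by fun_prop) one_add_I_mul_ne_zero
  have hc := continuous_one_add_I_mul_inv_sq (-(1 + Complex.I))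
  obtain ⟨M, hM⟩ := (isCompact_Icc (a := (0 : ℝ)) (b := 1)).exists_bound_of_continuousOn
    (f := fun x : ℝ => Complex.log (((1 : ℝ) : ℂ) / (1 + Complex.I * (x : ℂ)))) fun x hx =>
      ((Complex.differentiableAt_log (mem_slitPlane_of_mem_logSector
        (hinv x hx))).continuousAt.comp (f := fun x : ℝ => ((1 : ℝ) : ℂ) / (1 + Complex.I * (x : ℂ)))
          (Continuous.div (by fun_prop) (by fun_prop)
            one_add_I_mul_ne_zero).continuousAt).continuousWithinAt
  obtain ⟨N, hN⟩ := (isCompact_Icc (a := (0 : ℝ)) (b := 1)).exists_bound_of_continuousOn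
    hc.continuousOn
  have hlog : IntervalIntegrable (fun x => (1 + |Real.log (1 - x)|) ^ 2)
      MeasureTheory.volume 0 1 := by
    have := (intervalIntegrable_one_add_abs_log_sq.comp_sub_left 1).symm
    simpa using this
  have hi : IntervalIntegrable (fun x : ℝ =>
      logSqKernel Complex.I (((1 - x : ℝ) : ℂ) / (1 + Complex.I * x))
        * (-(1 + Complex.I) / (1 + Complex.I * x) ^ 2)) MeasureTheory.volume 0 1 := by
    -- Factor `u = (1-x) · 1/(1+ix)`: the second factor stays in a compact part of the sector, with
    -- `M` bounding its logarithm and `N` bounding `u'`.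
    refine (hlog.const_mul ((2 + 3) * (1 + M) ^ 2 * N)).mono_fun ?_ ?_
    · rw [Set.uIoc_of_le zero_le_one, ← MeasureTheory.restrict_Ioo_eq_restrict_Ioc]
      refine ContinuousOn.aestronglyMeasurable ?_ measurableSet_Ioo
      exact (hb.differentiableOn.continuousOn.comp hcont.continuousOn fun x hx =>
        (hmem x ⟨hx.1.le, hx.2⟩).2).mul hc.continuousOn
    · rw [Set.uIoc_of_le zero_le_one, ← MeasureTheory.restrict_Ioo_eq_restrict_Ioc]
      refine (MeasureTheory.ae_restrict_iff' measurableSet_Ioo).2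
        (Filter.Eventually.of_forall fun x hx => ?_)
      have hx' : x ∈ Set.Icc (0 : ℝ) 1 := Set.Ioo_subset_Icc_self hx
      have h1 := hb.norm_ofReal_mul_le (hinv x hx') (sub_pos.2 hx.2) (by linarith [hx.1])
      have h2 := hM x hx'
      have h3 := hN x hx'
      have hN0 : 0 ≤ N := (norm_nonneg _).trans h3
      have e1 : ((1 - x : ℝ) : ℂ) * (((1 : ℝ) : ℂ) / (1 + Complex.I * x))
          = ((1 - x : ℝ) : ℂ) / (1 + Complex.I * x) := by
        rw [Complex.ofReal_one, mul_one_div]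
      rw [e1] at h1
      simp only
      rw [norm_mul, Real.norm_of_nonneg (by positivity)]
      calc _ ≤ ((2 + 3) * (1 + M) ^ 2 * (1 + |Real.log (1 - x)|) ^ 2) * N :=
            mul_le_mul (h1.trans (by gcongr)) h3 (norm_nonneg _) (by positivity)
        _ = _ := by ring
  have hzero : Filter.Tendsto (fun x : ℝ => rayIntegral (logSqKernel Complex.I)
      (((1 - x : ℝ) : ℂ) / (1 + Complex.I * x))) (nhdsWithin 0 (Set.Ioi 0))
      (nhds (rayIntegral (logSqKernel Complex.I) 1)) := by
    have h1 := ContinuousAt.comp (x := (0 : ℝ)) (g := rayIntegral (logSqKernel Complex.I))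
      (f := fun x : ℝ => ((1 - x : ℝ) : ℂ) / (1 + Complex.I * (x : ℂ)))
      (hb.hasDerivAt_rayIntegral (hmem 0 (by simp))).continuousAt hcont.continuousAt
    have h2 := h1.tendsto.mono_left (nhdsWithin_le_nhds (s := Set.Ioi (0 : ℝ)))
    simpa [Function.comp_def] using h2
  have hone : Filter.Tendsto (fun x : ℝ => rayIntegral (logSqKernel Complex.I)
      (((1 - x : ℝ) : ℂ) / (1 + Complex.I * x))) (nhdsWithin 1 (Set.Iio 1)) (nhds 0) := by
    refine hb.tendsto_rayIntegral_zero ?_ ?_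
    · have h1 := (hcont.tendsto 1).mono_left (nhdsWithin_le_nhds (s := Set.Iio (1 : ℝ)))
      simpa using h1
    · filter_upwards [Ioo_mem_nhdsLT (zero_lt_one' ℝ)] with x hx
      exact hmem x ⟨hx.1.le, hx.2⟩
  have h := hb.integral_path (fun x _ => hasDerivAt_one_sub_div x)
    (fun x hx => hmem x ⟨hx.1.le, hx.2⟩) hi hzero hone
  refine ⟨hi.congr_uIoo (by rw [Set.uIoo_of_le zero_le_one]; exact e), ?_⟩
  rw [intervalIntegral_congr_Ioo e] at h
  rw [h, Complex.sub_im, im_rayIntegral_logSqKernel_I_one]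
  simp

/-! ### The value of `J` and the final formulas. -/

theorem integral_arctan_mul_log_one_sub_sq_div :
    ∫ x in (0 : ℝ)..1, Real.arctan x * Real.log (1 - x ^ 2) / x
      = -4 * (trilog (1 + Complex.I)).im + 2 * catalanConstant * Real.log 2
        + Real.pi / 4 * Real.log 2 ^ 2 + 3 * Real.pi ^ 3 / 32 := by
  obtain ⟨i1, h1⟩ := im_integral_log_sq_one_add_I_mul_div
  obtain ⟨i2, h2⟩ := im_integral_log_sq_one_add_div
  obtain ⟨i3, h3⟩ := im_integral_log_sq_one_sub_div
  -- With `L = log(1+x²)`, the squares have imaginary parts `L arctan x` and `-(2 log(1±x) - L)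
  -- arctan x`; the weights `1, -½, -½` cancel `L`.
  have key := im_intervalIntegral_eq (g := fun x => Real.arctan x * Real.log (1 - x ^ 2) / x)
    (i1.sub ((i2.add i3).const_mul ((1 / 2 : ℝ) : ℂ))) fun x hx => ?_
  · rw [← key, intervalIntegral.integral_sub i1 ((i2.add i3).const_mul _),
      intervalIntegral.integral_const_mul, intervalIntegral.integral_add i2 i3, Complex.sub_im,
      Complex.im_ofReal_mul, Complex.add_im, h1, h2, h3]
    ring
  · have hp : (0 : ℝ) < 1 + x := by linarith [hx.1]
    have hm : (0 : ℝ) < 1 - x := by linarith [hx.2]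
    have hl : Real.log (1 - x ^ 2) = Real.log (1 + x) + Real.log (1 - x) := by
      rw [← Real.log_mul hp.ne' hm.ne']
      ring_nf
    simp only [log_ofReal_div_one_add_mul_I hp, log_ofReal_div_one_add_mul_I hm,
      log_one_add_mul_I, sq (_ + _ * Complex.I)]
    rw [Complex.sub_im, Complex.im_ofReal_mul, Complex.add_im, Complex.div_ofReal_im,
      Complex.div_ofReal_im, Complex.div_ofReal_im, im_ofReal_mul_ofReal, im_ofReal_mul_ofReal,
      im_ofReal_mul_ofReal, hl]
    ring

theorem theorem6 (n : ℕ) :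
    (n = 0 →
      HasSum
        (fun k : ℕ => digammaTerm n (k + 1))
        ((-4 + 4 * Real.log 2 - Real.pi / 2 * Real.log 2 ^ 2 + Real.pi ^ 2 / 6
          - 11 * Real.pi ^ 3 / 48 - 4 * catalanConstant * Real.log 2
          + 8 * (trilog (1 + Complex.I)).im : ℝ) : ℂ)) ∧
    (n = 1 →
      HasSum
        (fun k : ℕ => digammaTerm n (k + 1))
        ((92 / 27 - Real.pi ^ 2 / 9 - 32 * Real.log 2 / 9 + Real.pi / 2 * Real.log 2 ^ 2
          + 11 * Real.pi ^ 3 / 48 + 4 * catalanConstant * Real.log 2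
          - 8 * (trilog (1 + Complex.I)).im : ℝ) : ℂ)) ∧
    (Odd n → n ≠ 1 →
      HasSum
        (fun k : ℕ => digammaTerm n (k + 1))
        ((92 / 27
          + 16 * ∑ j ∈ Finset.Icc 1 ((n - 1) / 2),
              (2 * (j : ℝ) + 1) * (2 * (harmonic (4 * j + 1) : ℝ) - (harmonic (2 * j) : ℝ))
                / ((4 * (j : ℝ) + 3) ^ 2 * (4 * (j : ℝ) + 1) ^ 2)
          - 4 * ∑ j ∈ Finset.Icc 1 ((n - 1) / 2), 1 / (4 * (j : ℝ) + 3) ^ 3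
          - Real.pi ^ 2 * (1 / 9
              + 1 / 3 * ∑ j ∈ Finset.Icc 1 ((n - 1) / 2),
                  1 / ((4 * (j : ℝ) + 3) * (4 * (j : ℝ) + 1)))
          - Real.log 2 * (32 / 9
              + 32 * ∑ j ∈ Finset.Icc 1 ((n - 1) / 2),
                  (2 * (j : ℝ) + 1) / ((4 * (j : ℝ) + 3) ^ 2 * (4 * (j : ℝ) + 1) ^ 2))
          + Real.pi / 2 * Real.log 2 ^ 2
          + 11 * Real.pi ^ 3 / 48 + 4 * catalanConstant * Real.log 2
          - 8 * (trilog (1 + Complex.I)).im : ℝ) : ℂ)) ∧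
    (Even n →
      HasSum
        (fun k : ℕ => digammaTerm n (k + 1))
        ((-4
          + 32 * ∑ j ∈ Finset.range (n / 2),
              ((j : ℝ) + 1) * (2 * (harmonic (4 * j + 3) : ℝ) - (harmonic (2 * j + 1) : ℝ))
                / ((4 * (j : ℝ) + 5) ^ 2 * (4 * (j : ℝ) + 3) ^ 2)
          - 4 * ∑ j ∈ Finset.range (n / 2), 1 / (4 * (j : ℝ) + 5) ^ 3
          + Real.pi ^ 2 * (1 / 6
              - 1 / 3 * ∑ j ∈ Finset.range (n / 2),
                  1 / ((4 * (j : ℝ) + 5) * (4 * (j : ℝ) + 3)))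
          + Real.log 2 * (4
              - 64 * ∑ j ∈ Finset.range (n / 2),
                  ((j : ℝ) + 1) / ((4 * (j : ℝ) + 5) ^ 2 * (4 * (j : ℝ) + 3) ^ 2))
          - Real.pi / 2 * Real.log 2 ^ 2
          - 11 * Real.pi ^ 3 / 48 - 4 * catalanConstant * Real.log 2
          + 8 * (trilog (1 + Complex.I)).im : ℝ) : ℂ)) := by
  have h : ∀ n, HasSum (fun k : ℕ => digammaTerm n (k + 1)) ((thetaSeq _ n : ℝ) : ℂ) :=
    hasSum_digammaTerm hasSum_arctanMoment_div_sq
  -- Here `J` becomes explicit; its cubic part is `π³/24 + 2 · 3π³/32 = 11π³/48`.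
  rw [integral_arctan_mul_log_one_sub_sq_div] at h
  refine ⟨?_, ?_, ?_, ?_⟩
  · rintro rfl
    convert! h (2 * 0) using 2
    rw [thetaSeq_even]
    simp
    ring
  · rintro rfl
    convert! h (2 * 0 + 1) using 2
    rw [thetaSeq_odd]
    simp
    ring
  · rintro ⟨m, rfl⟩ -
    convert! h (2 * m + 1) using 2
    rw [thetaSeq_odd, show (2 * m + 1 - 1) / 2 = m by omega]
    ring
  · rintro ⟨m, rfl⟩
    rw [← two_mul]
    convert! h (2 * m) using 2
    rw [thetaSeq_even, show 2 * m / 2 = m by omega]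
    ring
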